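/- A *ribbon graph* $G=(V(G),E(G))$ is a (possibly non-orientable) compact surface with boundary, presented as the union of a finite set $V(G)$ of discs (vertices) and a finite set $E(G)$ of discs (edges), such that vertices and edges meet in disjoint line segments, each segment lies on the boundary of exactly one vertex and exactly one edge, and each edge contains exactly two segments. Ribbon subgraphs are obtained by deleting vertices and edges. For $A\subseteq E(G)$, let $A^c=E(G)\setminus A$, let $G|_A$ be the ribbon subgraph formed by the edges in $A$ and their incident vertices, and let $G-A$ be the spanning ribbon subgraph with edge set $A^c$. A connected ribbon graph is *plane* if its Euler genus is $0$, and is an *$\mathbb{R}\mathrm{P}^2$ ribbon graph* if its Euler genus is $1$; here the Euler genus is $2-(v-e+f)$, with $v$, $e$, $f$ the numbers of vertices, edges and boundary components (that is, twice the genus in the orientable case, and the genus in the non-orientable case). We write $K=P\oplus Q$ (a *1-sum at $v$*) if $P,Q$ are connected ribbon subgraphs with at least one edge each, $K=P\cup Q$ and $P\cap Q=\{v\}$ for a vertex $v$. It is a *join*, $K=P\vee Q$, if moreover there is an arc on the boundary of $v$ such that all edges of $P$ incident to $v$ meet it on this arc and no edges of $Q$ do. Iterated 1-sums and joins are bracketed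 to the left: $H_1\oplus\cdots\oplus H_l=(\cdots(H_1\oplus H_2)\oplus\cdots)\oplus H_l$, and likewise for $\vee$. Let $G$ be connected. A set $A\subseteq E(G)$ *defines a biseparation* of $G$ if $A=\emptyset$, or $A=E(G)$, or $G=H_1\oplus\cdots\oplus H_l$ where $H_1,\dots,H_l$ are the components of $G|_A$ and of $G|_{A^c}$, each occurring exactly once. It defines a *plane-biseparation* if, in addition, every component of $G|_A$ and of $G-A$ is plane; it defines an *$\mathbb{R}\mathrm{P}^2$-biseparation* if, in addition, exactly one component of $G|_A$ or of $G-A$ is an $\mathbb{R}\mathrm{P}^2$ ribbon graph and all the others are plane. If $G=H_1\vee\cdots\vee H_r$ with $r\ge 1$, then for each $i$ the set $A\,\Delta\,E(H_i)$ is said to be obtained from $A\subseteq E(G)$ by *toggling a join-summand*. (The case $r=1$, $H_1=G$, is allowed. No condition is put on $A$.) **Theorem.** Let $G$ be a connected ribbon graph and let $A,B\subseteq E(G)$ either both define plane-biseparations of $G$, or both define $\mathbb{R}\mathrm{P}^2$-biseparations of $G$. Then $A$ and $B$ are related by toggling join-summands: there is a finite sequence of sets $A=A_1,A_2,\dots,A_n=B$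 in which each $A_{i+1}$ is obtained from $A_i$ by toggling a join-summand of $G$. -/

import Mathlib

/-- A (possibly non-orientable) ribbon graph with vertex discs `V` and edge ribbons `E`, encoded by
a signed rotation system (equivalently, an arrow presentation). The edge `e` meets the vertex discs
in two line segments, its half-edges `(e, false)` and `(e, true)`. Every vertex disc carries an
arbitrarily chosen orientation, `rot` sends a half-edge to the next one around the boundary of its
vertex, and `twisted e` tells whether the ribbon `e` is half-twisted with respect to the chosen
orientations at its two ends. A vertex may have no half-edges at all. -/
structure RibbonGraph (V : Type*) (E : Type*) where
  /-- the vertex disc that a half-edge lies on -/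
  vtx : E × Bool → V
  /-- the next half-edge around the same vertex disc -/
  rot : Equiv.Perm (E × Bool)
  /-- whether the ribbon is half-twisted -/
  twisted : E → Bool
  /-- the half-edges at a vertex form a single cycle of the rotation -/
  sameCycle_iff : ∀ h h' : E × Bool, rot.SameCycle h h' ↔ vtx h = vtx h'

namespace RibbonGraph

variable {V E : Type*}

/-- A ribbon subgraph: some of the vertices and some of the edges, the ends of
each chosen edge being chosen. -/
@[ext]
structure Subgraph (G : RibbonGraph V E) where
  /-- the vertices of the subgraph -/
  verts : Set V
  /-- the edges of the subgraph -/
  edges : Set E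
  /-- edges come with both their ends -/
  ends_mem : ∀ e ∈ edges, ∀ b : Bool, G.vtx (e, b) ∈ verts

/-- Containment of ribbon subgraphs. -/
instance (G : RibbonGraph V E) : LE G.Subgraph where
  le P Q := P.verts ⊆ Q.verts ∧ P.edges ⊆ Q.edges

/-- `G` as a ribbon subgraph of itself. -/
def whole (G : RibbonGraph V E) : G.Subgraph where
  verts := Set.univ
  edges := Set.univ
  ends_mem := fun _ _ _ => Set.mem_univ _

/-- The induced ribbon subgraph `G|_A`: the edges in `A` and their incident vertices. -/
def induced (G : RibbonGraph V E) (A : Set E) : G.Subgraph where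
  verts := {v | ∃ e ∈ A, ∃ b : Bool, G.vtx (e, b) = v}
  edges := A
  ends_mem := fun e he b => ⟨e, he, b, rfl⟩

/-- The spanning ribbon subgraph `G - A`, obtained by deleting the edges in `A`. -/
def deleteEdges (G : RibbonGraph V E) (A : Set E) : G.Subgraph where
  verts := Set.univ
  edges := Aᶜ
  ends_mem := fun _ _ _ => Set.mem_univ _

namespace Subgraph

variable {G : RibbonGraph V E}

/-- `v` and `w` are the two ends of an edge of `H`. -/
def Adj (H : G.Subgraph) (v w : V) : Prop :=
  ∃ e ∈ H.edges, ∃ b : Bool, G.vtx (e, b) = v ∧ G.vtx (e, !b) = w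

/-- `H` is non-empty and any two of its vertices are joined by a path in `H`. -/
def Connected (H : G.Subgraph) : Prop :=
  H.verts.Nonempty ∧ ∀ v ∈ H.verts, ∀ w ∈ H.verts, Relation.ReflTransGen H.Adj v w

/-- `C` is a connected component of `H`: a maximal connected ribbon subgraph of `H`. -/
def IsComponent (C H : G.Subgraph) : Prop :=
  Maximal (fun D : G.Subgraph => D ≤ H ∧ D.Connected) C

end Subgraph

/-- The segment in which the half-edge `h` meets its vertex disc has two end-points: `(h, false)`,
where it begins, and `(h, true)`, where it finishes, with respect to the chosen orientation of the
vertex. This relation joins two such points when they are consecutive on the boundary of the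
spanning ribbon subgraph with edge set `C`, embedded in `G`:
* `corner`: the arc of a vertex boundary between consecutive half-edges;
* `along`: a side of a ribbon in `C` (sides match the finish at one end with the beginning
  at the other if the ribbon is untwisted, and finish with finish, beginning with beginning
  if it is twisted);
* `across`: the arc of a vertex boundary where a deleted edge was attached. -/
inductive BoundaryStep (G : RibbonGraph V E) (C : Set E) :
    (E × Bool) × Bool → (E × Bool) × Bool → Prop
  | corner (h : E × Bool) : BoundaryStep G C (h, true) (G.rot h, false)
  | along (e : E) (b s : Bool) (he : e ∈ C) :
      BoundaryStep G C ((e, b), s) ((e, !b), if G.twisted e then s else !s)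
  | across (h : E × Bool) (s : Bool) (hh : h.1 ∉ C) : BoundaryStep G C (h, s) (h, !s)

namespace Subgraph

variable {G : RibbonGraph V E}

/-- The number of boundary components of the surface `H`: the classes of points that lie on the
vertices of `H`, and one circle for each vertex of `H` on which there are no such points. -/
noncomputable def numBoundary (H : G.Subgraph) : ℕ :=
  Set.ncard {x : Quot (G.BoundaryStep H.edges) |
    ∃ (h : E × Bool) (s : Bool), G.vtx h ∈ H.verts ∧ x = Quot.mk _ (h, s)} +
  Set.ncard {v : V | v ∈ H.verts ∧ ∀ h : E × Bool, G.vtx h ≠ v}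

/-- The Euler genus of a connected ribbon (sub)graph: capping off the boundary components gives a
closed connected surface of Euler characteristic `χ = v - e + f`, and `2 - χ` is twice its genus if
it is orientable and its genus if it is not. -/
noncomputable def eulerGenus (H : G.Subgraph) : ℤ :=
  2 - ((H.verts.ncard : ℤ) - (H.edges.ncard : ℤ) + (H.numBoundary : ℤ))

/-- Plane ribbon graphs: connected, of Euler genus zero. -/
def IsPlane (H : G.Subgraph) : Prop := H.Connected ∧ H.eulerGenus = 0

/-- Real projective plane ribbon graphs: connected, of Euler genus one. -/
def IsRP2 (H : G.Subgraph) : Prop := H.Connected ∧ H.eulerGenus = 1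

/-- `K = P ⊕ Q` is a 1-sum occurring at the vertex `v`: `P` and `Q` are connected and non-trivial
(they have an edge), `K = P ∪ Q` and `P ∩ Q = {v}`. -/
structure IsOneSumAt (K P Q : G.Subgraph) (v : V) : Prop where
  connected_left : P.Connected
  connected_right : Q.Connected
  nontrivial_left : P.edges.Nonempty
  nontrivial_right : Q.edges.Nonempty
  verts_union : K.verts = P.verts ∪ Q.verts
  edges_union : K.edges = P.edges ∪ Q.edges
  verts_inter : P.verts ∩ Q.verts = {v}
  edges_inter : P.edges ∩ Q.edges = ∅

/-- `K = P ⊕ Q`. -/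
def IsOneSum (K P Q : G.Subgraph) : Prop := ∃ v : V, IsOneSumAt K P Q v

/-- `K = P ∨ Q`: a 1-sum at some `v` such that some arc of the boundary of `v` is met by all edges
of `P` that are incident to `v`, and by no edge of `Q`. The arc is given by the run of `n`
consecutive half-edges of `G` at `v` that starts at `h₀`. -/
def IsJoin (K P Q : G.Subgraph) : Prop :=
  ∃ v : V, IsOneSumAt K P Q v ∧
    ∃ (h₀ : E × Bool) (n : ℕ), G.vtx h₀ = v ∧
      (∀ h : E × Bool, G.vtx h = v → h.1 ∈ P.edges → ∃ i < n, (G.rot ^ i) h₀ = h) ∧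
      (∀ i < n, ((G.rot ^ i) h₀).1 ∉ Q.edges)

/-- `IsIterated op K [H₁, …, H_l]` says that `K = (⋯((H₁ * H₂) * H₃) ⋯) * H_l` with `l ≥ 1`, where
`op K P Q` stands for `K = P * Q`. -/
inductive IsIterated (op : G.Subgraph → G.Subgraph → G.Subgraph → Prop) :
    G.Subgraph → List G.Subgraph → Prop
  | single (H : G.Subgraph) : IsIterated op H [H]
  | snoc (K K' H : G.Subgraph) (L : List G.Subgraph) (hL : IsIterated op K L)
      (hK : op K' K H) : IsIterated op K' (L ++ [H])

end Subgraph

open Subgraph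

/-- `G` is connected. -/
def Connected (G : RibbonGraph V E) : Prop := G.whole.Connected

/-- `A` defines a biseparation: it is trivial, or `G = H₁ ⊕ ⋯ ⊕ H_l` where the summands are the
components of `G|_A` and of `G|_{Aᶜ}`, each occurring once. (Two components with a common vertex
cannot be on the same side, so each 1-sum involves a component of `G|_A` and one of `G|_{Aᶜ}`.) -/
def DefinesBiseparation (G : RibbonGraph V E) (A : Set E) : Prop :=
  A = Set.univ ∨ A = ∅ ∨
    ∃ L : List G.Subgraph, L.Nodup ∧
      (∀ H : G.Subgraph, H ∈ L ↔ (IsComponent H (G.induced A) ∨ IsComponent H (G.induced Aᶜ))) ∧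
      IsIterated IsOneSum G.whole L

/-- `C` is a component of `G|_A` or of `G - A`. -/
def IsPart (G : RibbonGraph V E) (A : Set E) (C : G.Subgraph) : Prop :=
  IsComponent C (G.induced A) ∨ IsComponent C (G.deleteEdges A)

/-- `A` defines a plane-biseparation. -/
def DefinesPlaneBiseparation (G : RibbonGraph V E) (A : Set E) : Prop :=
  G.DefinesBiseparation A ∧ ∀ C : G.Subgraph, G.IsPart A C → C.IsPlane

/-- `A` defines a biseparation in which exactly one component of `G|_A` or of `G - A` is a
real projective plane ribbon graph and all the other components are plane. -/
def DefinesRP2Biseparation (G : RibbonGraph V E) (A : Set E) : Prop :=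
  G.DefinesBiseparation A ∧
    ∃ C : G.Subgraph, G.IsPart A C ∧ C.IsRP2 ∧
      ∀ D : G.Subgraph, G.IsPart A D → D ≠ C → D.IsPlane

/-- `B` is obtained from `A` by toggling a join-summand: `B = A Δ E(H_i)` for some
`G = H₁ ∨ ⋯ ∨ H_r`, `r ≥ 1`, and some `i`. -/
def IsToggle (G : RibbonGraph V E) (A B : Set E) : Prop :=
  ∃ L : List G.Subgraph, IsIterated IsJoin G.whole L ∧ ∃ H ∈ L, B = symmDiff A H.edges

/-- `A` and `B` are related by a (finite, possibly empty) sequence of toggles of join-summands. -/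
def RelatedByToggling (G : RibbonGraph V E) (A B : Set E) : Prop :=
  Relation.ReflTransGen G.IsToggle A B

end RibbonGraph

/-! Give every edge the four end-points of its two segments. The medial graph has the edges of `G`
as its vertices, and the vertex arcs between consecutive half-edges, given by the matching `corner`,
as its edges. At each edge there are two pairings of the four points, `across` and `along`. The
boundary of the spanning subgraph on `A`, with `f(A)` components, is traced by `corner` together
with the pairing that is `along` on `A` and `across` elsewhere.

Adding up Euler genera over the summands of a biseparation gives `f(A) + f(Aᶜ) ≥ |E| + 1`, for plane
and for projective biseparations alike (`card_edges_lt_of_genus`). Geometrically, the circuits for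
`A` and for `Aᶜ` bound the faces of an embedding of the medial graph, on the surface of the partial
dual of `G`, and this surface has Euler genus at most one.

Passing from `A` to `B` exchanges the two pairings on `C = A Δ B`, and the genus is at most one
before and after. The core is `TransitionPair.cutGenerated`: such a `C` is a symmetric difference of
sets of medial vertices bounded by at most two medial edges' ends (`cutPts`). In a connected `G`
such a set is empty, everything, or a join-summand (`relatedByToggling_of_small_cut`), so the
theorem follows.

For the core, surgery along a non-empty two-point cut raises each of the four circuit counts by at
least one and the number of components by at most one, so the genus hypotheses survive and induction
applies. Suppose no such cut is left. A circuit crossing the boundary of `C` exactly twice could be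
short-cut, and Euler's inequality would then produce a two-point cut; hence every circuit that
crosses does so at least four times (`eight_le_ncard_circuit`). Few circuits cross, so cutting all
crossing medial edges leaves more circuits than Euler's inequality for partial matchings permits
(`two_mul_numCirc_closeUp_add_le`), unless nothing crosses (`cutPts_eq_empty_of_no_small_cut`). -/

namespace RibbonGraph

/-! ### Counting classes of relations, and parity of involutions -/

section Counting

variable {α β : Type*}

theorem mem_iff_of_mk_eq {r : α → α → Prop} {K : Set α} (hK : ∀ x y, r x y → (x ∈ K ↔ y ∈ K))
    {x y : α} (h : Quot.mk r x = Quot.mk r y) : x ∈ K ↔ y ∈ K :=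
  iff_of_eq (congrArg (Quot.lift (fun z => z ∈ K) fun a b hab => propext (hK a b hab)) h)

theorem mk_eq_map {r : α → α → Prop} {r' : β → β → Prop} (f : α → β)
    (hf : ∀ x y, r x y → Quot.mk r' (f x) = Quot.mk r' (f y)) {x y : α}
    (h : Quot.mk r x = Quot.mk r y) : Quot.mk r' (f x) = Quot.mk r' (f y) :=
  congrArg (Quot.lift (fun z => Quot.mk r' (f z)) hf) h

theorem card_quot_le_of_map [Finite α] {r : α → α → Prop} {r' : β → β → Prop} (f : α → β)
    (hf : ∀ x y, r x y → Quot.mk r' (f x) = Quot.mk r' (f y)) (hs : Function.Surjective f) :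
    Nat.card (Quot r') ≤ Nat.card (Quot r) := by
  refine Nat.card_le_card_of_surjective (Quot.lift (fun z => Quot.mk r' (f z)) hf) fun q => ?_
  induction q using Quot.ind with
  | mk y => obtain ⟨x, rfl⟩ := hs y; exact ⟨Quot.mk r x, rfl⟩

theorem card_quot_le [Finite α] {r r' : α → α → Prop}
    (h : ∀ x y, r x y → Quot.mk r' x = Quot.mk r' y) : Nat.card (Quot r') ≤ Nat.card (Quot r) :=
  card_quot_le_of_map id h Function.surjective_id

theorem card_quot_lt [Finite α] {r r' : α → α → Prop}
    (h : ∀ x y, r x y → Quot.mk r' x = Quot.mk r' y) {a b : α}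
    (hab : Quot.mk r' a = Quot.mk r' b) (hn : Quot.mk r a ≠ Quot.mk r b) :
    Nat.card (Quot r') + 1 ≤ Nat.card (Quot r) := by
  have hs : Function.Surjective (Quot.lift (fun z => Quot.mk r' z) h) := by
    intro q
    induction q using Quot.ind with
    | mk y => exact ⟨Quot.mk r y, rfl⟩
  have hle := Nat.card_le_card_of_surjective _ hs
  refine lt_of_le_of_ne hle fun heq => hn ?_
  exact (hs.bijective_of_nat_card_le heq.ge).1 hab

/-- Identifying two classes lowers the number of classes by at most one. -/
theorem card_quot_le_succ [Finite α] {r r' : α → α → Prop} (a b : α)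
    (h : ∀ x y, r' x y → Quot.mk r x = Quot.mk r y ∨
      ((Quot.mk r x = Quot.mk r a ∨ Quot.mk r x = Quot.mk r b) ∧
        (Quot.mk r y = Quot.mk r a ∨ Quot.mk r y = Quot.mk r b))) :
    Nat.card (Quot r) ≤ Nat.card (Quot r') + 1 := by
  classical
  -- Merging the class of `b` into that of `a` makes the map constant on classes of `r'`; the lost
  -- class is recovered from the extra point `none`.
  let φ : α → Quot r := fun x => if Quot.mk r x = Quot.mk r b then Quot.mk r a else Quot.mk r x
  have hφ : ∀ x y, r' x y → φ x = φ y := by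
    intro x y hxy
    simp only [φ]
    rcases h x y hxy with h | ⟨h1 | h1, h2 | h2⟩
    · rw [h]
    all_goals rw [h1, h2]; try split_ifs <;> rfl
    all_goals simp
  let ψ : Option (Quot r') → Quot r := fun o => o.elim (Quot.mk r b) (Quot.lift φ hφ)
  have hψ : Function.Surjective ψ := by
    intro q
    induction q using Quot.ind with
    | mk y =>
      by_cases hy : Quot.mk r y = Quot.mk r b
      · exact ⟨none, hy.symm⟩
      · exact ⟨some (Quot.mk r' y), if_neg hy⟩
  have := Nat.card_le_card_of_surjective ψ hψ
  rwa [Finite.card_option] at this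

theorem even_ncard_of_involution [Finite α] {K : Set α} (σ : α → α) (hK : ∀ x ∈ K, σ x ∈ K)
    (hσ : ∀ x ∈ K, σ (σ x) = x) (hne : ∀ x ∈ K, σ x ≠ x) : Even K.ncard := by
  classical
  have := Fintype.ofFinite α
  have h : ∑ x ∈ K.toFinset, (1 : ZMod 2) = 0 :=
    Finset.sum_involution (fun x _ => σ x) (fun _ _ => by decide)
      (fun x hx _ => hne x (by simpa using hx)) (fun x hx => by simpa using hK x (by simpa using hx))
      (fun x hx => hσ x (by simpa using hx))
  rw [Finset.sum_const, nsmul_eq_mul, mul_one, ZMod.natCast_eq_zero_iff_even] at h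
  rwa [Set.ncard_eq_toFinset_card']

/-- In a set closed under a fixed-point free involution `σ`, and under a fixed-point free involution
`ρ` except perhaps at `a` and `b`, the point `a` is not the only exception. -/
theorem mem_of_closed_except [Finite α] {K : Set α} {σ ρ : α → α} {a b : α} (ha : a ∈ K)
    (hK : ∀ x ∈ K, σ x ∈ K) (hσ : ∀ x, σ (σ x) = x) (hσn : ∀ x, σ x ≠ x)
    (hρ : ∀ x ∈ K, x ≠ a → x ≠ b → ρ x ∈ K ∧ ρ x ≠ a) (hρi : ∀ x, ρ (ρ x) = x)
    (hρn : ∀ x, ρ x ≠ x) : b ∈ K := by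
  by_contra hb
  have h1 : Even K.ncard :=
    even_ncard_of_involution σ hK (fun x _ => hσ x) (fun x _ => hσn x)
  have h2 : Even (K \ {a}).ncard := by
    refine even_ncard_of_involution ρ (fun x hx => ?_) (fun x _ => hρi x) (fun x _ => hρn x)
    exact hρ x hx.1 hx.2 (fun h => hb (h ▸ hx.1))
  have h3 := Set.ncard_sdiff_singleton_add_one ha K.toFinite
  rcases h1 with ⟨m, hm⟩
  rcases h2 with ⟨n, hn⟩
  omega

/-- If each point of `U` lies in a fibre of `f` with at least `n` points of `U`, then `f` has at most
`|U| / n` values on `U`. -/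
theorem mul_ncard_image_le [Finite α] (f : α → β) (U : Set α) (n : ℕ)
    (h : ∀ u ∈ U, n ≤ {x | x ∈ U ∧ f x = f u}.ncard) : n * (f '' U).ncard ≤ U.ncard := by
  classical
  have := Fintype.ofFinite α
  have h1 : (f '' U).ncard = (U.toFinset.image f).card := by
    rw [← Set.ncard_coe_finset]; simp
  rw [h1, Set.ncard_eq_toFinset_card' U, Finset.card_eq_sum_card_image f U.toFinset, mul_comm,
    ← smul_eq_mul]
  refine Finset.card_nsmul_le_sum _ _ _ fun y hy => ?_
  obtain ⟨u, hu, rfl⟩ := Finset.mem_image.1 hy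
  refine (h u (by simpa using hu)).trans_eq ?_
  rw [← Set.ncard_coe_finset]
  congr 1
  ext x
  simp

/-- The number of classes is the number of classes that meet `U` plus the number of those that do
not. -/
theorem card_quot_eq_add [Finite α] (r : α → α → Prop) (U : Set α) :
    Nat.card (Quot r) = (Quot.mk r '' U).ncard + ((Quot.mk r '' U)ᶜ).ncard :=
  (Set.ncard_add_ncard_compl _).symm

/-- Two symmetric relations that agree off `U` have the same classes disjoint from `U`. -/
theorem ncard_avoiding_le [Finite α] {r r' : α → α → Prop} {U : Set α} (f : α ≃ α)
    (hU : ∀ x, f x ∈ U ↔ x ∈ U) (hsymm : ∀ x y, r' x y → r' y x)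
    (h : ∀ x y, x ∉ U → r' (f x) (f y) → r x y) :
    ((Quot.mk r '' U)ᶜ).ncard ≤ ((Quot.mk r' '' U)ᶜ).ncard := by
  have key : ∀ x y, Quot.mk r x ∉ Quot.mk r '' U → Quot.mk r' (f x) = Quot.mk r' (f y) →
      Quot.mk r x = Quot.mk r y := by
    intro x y hx hxy
    have hstep : ∀ y z, Quot.mk r (f.symm y) = Quot.mk r x → r' y z →
        Quot.mk r (f.symm z) = Quot.mk r x := by
      intro y z hy hyz
      have hyU : f.symm y ∉ U := fun hyU => hx ⟨_, hyU, hy⟩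
      exact (Quot.sound (h _ (f.symm z) hyU (by simpa using hyz))).symm.trans hy
    have := (mem_iff_of_mk_eq (r := r') (K := {z | Quot.mk r (f.symm z) = Quot.mk r x})
      (fun y z hyz => ⟨fun hy => hstep y z hy hyz, fun hz => hstep z y hz (hsymm y z hyz)⟩)
      hxy).1 (by simp)
    simpa using this.symm
  refine Set.ncard_le_ncard_of_injOn (fun q => Quot.mk r' (f q.out)) (fun q hq => ?_)
    (fun q hq q' _ hqq' => ?_) (Set.toFinite _)
  · rintro ⟨u, hu, huq⟩
    have hq' : Quot.mk r q.out ∉ Quot.mk r '' U := by rwa [Quot.out_eq]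
    refine hq' ⟨f.symm u, ?_, (key _ _ hq' ?_).symm⟩
    · rw [← hU]; simpa using hu
    · simpa using huq.symm
  · have hq' : Quot.mk r q.out ∉ Quot.mk r '' U := by rwa [Quot.out_eq]
    simpa using key _ _ hq' hqq'

end Counting

/-! ### Euler's inequality for the medial graph with some edges cut -/

section Euler

variable {D E : Type*}

/-- The orbits of the group generated by two involutions are the classes of this relation. -/
def Circ {α : Type*} (c σ : α → α) (x y : α) : Prop := y = c x ∨ y = σ x

/-- The number of circuits formed by two perfect matchings. -/
noncomputable def numCirc {α : Type*} (c σ : α → α) : ℕ := Nat.card (Quot (Circ c σ))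

theorem circ_symm {α : Type*} {c σ : α → α} (hc : ∀ x, c (c x) = x) (hσ : ∀ x, σ (σ x) = x)
    (x y : α) (h : Circ c σ x y) : Circ c σ y x := by
  rcases h with rfl | rfl
  · exact Or.inl (hc x).symm
  · exact Or.inr (hσ x).symm

theorem circ_mk_left {α : Type*} {c σ : α → α} (x : α) :
    Quot.mk (Circ c σ) (c x) = Quot.mk (Circ c σ) x := (Quot.sound (r := Circ c σ) (Or.inl rfl)).symm

theorem circ_mk_right {α : Type*} {c σ : α → α} (x : α) :
    Quot.mk (Circ c σ) (σ x) = Quot.mk (Circ c σ) x := (Quot.sound (r := Circ c σ) (Or.inr rfl)).symm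

/-- Adjacency of edges in the medial graph. -/
def MedialAdj (π : D → E) (c : D → D) (e e' : E) : Prop := ∃ d, π d = e ∧ π (c d) = e'

/-- The number of components of the medial graph. -/
noncomputable def numMedial (π : D → E) (c : D → D) : ℕ := Nat.card (Quot (MedialAdj π c))

theorem medial_mk {π : D → E} {c : D → D} (d : D) :
    Quot.mk (MedialAdj π c) (π (c d)) = Quot.mk (MedialAdj π c) (π d) :=
  (Quot.sound ⟨d, rfl, rfl⟩).symm

/-- A pairing of the points of each edge. -/
structure Transition (π : D → E) (σ : D → D) : Prop where
  invol : ∀ d, σ (σ d) = d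
  ne : ∀ d, σ d ≠ d
  fiber : ∀ d, π (σ d) = π d

/-- Two transitions on edges with four points each that are everywhere different. -/
structure TransitionPair (π : D → E) (σ τ : D → D) : Prop where
  left : Transition π σ
  right : Transition π τ
  gen : ∀ d d', π d = π d' → d' = d ∨ d' = σ d ∨ d' = τ d ∨ d' = σ (τ d)
  surj : Function.Surjective π
  comm : ∀ d, σ (τ d) = τ (σ d)
  card : Nat.card D = 4 * Nat.card E

/-- `σ` on one copy of the points and `τ` on another one. -/
def double (σ τ : D → D) (x : D × Bool) : D × Bool := (if x.2 then τ x.1 else σ x.1, x.2)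

open Classical in
/-- The partial matching `c` on both copies of the points; unmatched points are joined to their
copies. -/
noncomputable def closeUp (c : D → D) (x : D × Bool) : D × Bool :=
  if c x.1 = x.1 then (x.1, !x.2) else (c x.1, x.2)

theorem double_invol {σ τ : D → D} (hσ : ∀ d, σ (σ d) = d) (hτ : ∀ d, τ (τ d) = d)
    (x : D × Bool) : double σ τ (double σ τ x) = x := by
  rcases x with ⟨d, _ | _⟩ <;> simp [double, hσ, hτ]

theorem double_ne {σ τ : D → D} (hσ : ∀ d, σ d ≠ d) (hτ : ∀ d, τ d ≠ d)
    (x : D × Bool) : double σ τ x ≠ x := by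
  rcases x with ⟨d, _ | _⟩ <;> simp [double, hσ, hτ]

theorem closeUp_invol {c : D → D} (hc : ∀ d, c (c d) = d) (x : D × Bool) :
    closeUp c (closeUp c x) = x := by
  rcases x with ⟨d, b⟩
  by_cases h : c d = d
  · simp [closeUp, h]
  · have h' : d ≠ c d := fun h' => h h'.symm
    simp [closeUp, h, hc, h']

theorem closeUp_ne {c : D → D} (x : D × Bool) : closeUp c x ≠ x := by
  rcases x with ⟨d, b⟩
  by_cases h : c d = d <;> simp [closeUp, h]

theorem double_fst {π : D → E} {σ τ : D → D} (h : TransitionPair π σ τ) (x : D × Bool) :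
    π (double σ τ x).1 = π x.1 := by
  rcases x with ⟨d, _ | _⟩ <;> simp [double, h.left.fiber, h.right.fiber]

theorem medial_mk_of_circ {π : D → E} {σ τ c : D → D} (h : TransitionPair π σ τ)
    (x y : D × Bool) (hxy : Circ (closeUp c) (double σ τ) x y) :
    Quot.mk (MedialAdj π c) (π x.1) = Quot.mk (MedialAdj π c) (π y.1) := by
  rcases hxy with rfl | rfl
  · by_cases hx : c x.1 = x.1
    · simp [closeUp, hx]
    · simp [closeUp, hx, medial_mk]
  · rw [double_fst h]

open Classical in
/-- Unmatch the points `u` and `c u`. -/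
noncomputable def unpair (c : D → D) (u d : D) : D := if d = u ∨ d = c u then d else c d

theorem unpair_invol {c : D → D} (hc : ∀ d, c (c d) = d) (u d : D) :
    unpair c u (unpair c u d) = d := by
  unfold unpair
  by_cases h : d = u ∨ d = c u
  · simp [h]
  · have h1 : ¬ (c d = u ∨ c d = c u) := by
      rintro (h1 | h1)
      · exact h (Or.inr (by rw [← h1, hc]))
      · exact h (Or.inl (by rw [← hc d, h1, hc]))
    simp [h, h1, hc]

/-- Both sides of a bridge belong to the same face. A circuit leaving one copy of `u` without using
the bridge cannot reach `c u`, and by parity it can only end at the other copy of `u`. -/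
theorem mk_unpair_left [Finite D] {c σ τ : D → D} {π : D → E} (hc : ∀ d, c (c d) = d)
    (hp : TransitionPair π σ τ) {u : D} (hu : c u ≠ u)
    (hn : Quot.mk (MedialAdj π (unpair c u)) (π u) ≠
      Quot.mk (MedialAdj π (unpair c u)) (π (c u))) :
    Quot.mk (Circ (closeUp c) (double σ τ)) (u, false) =
      Quot.mk (Circ (closeUp c) (double σ τ)) (u, true) := by
  let r₀ : D × Bool → D × Bool → Prop := fun x y =>
    y = double σ τ x ∨ (x.1 ≠ u ∧ x.1 ≠ c u ∧ y = closeUp c x)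
  have h1 : ∀ x y, r₀ x y → Quot.mk (Circ (closeUp c) (double σ τ)) x =
      Quot.mk (Circ (closeUp c) (double σ τ)) y := by
    rintro x y (h | ⟨-, -, h⟩)
    · exact Quot.sound (Or.inr h)
    · exact Quot.sound (Or.inl h)
  have h2 : ∀ x y, r₀ x y → Quot.mk (MedialAdj π (unpair c u)) (π x.1) =
      Quot.mk (MedialAdj π (unpair c u)) (π y.1) := by
    rintro x y (rfl | ⟨hx, hx', rfl⟩)
    · rw [double_fst hp]
    · by_cases hcx : c x.1 = x.1
      · simp [closeUp, hcx]
      · have := medial_mk (π := π) (c := unpair c u) x.1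
        simp only [unpair, hx, hx', or_self, if_false] at this
        simpa [closeUp, hcx] using this.symm
  -- What `(u, false)` reaches without crossing the medial edge from `u` to `c u`.
  let K : Set (D × Bool) := {x | Quot.mk r₀ x = Quot.mk r₀ (u, false)}
  have hKw : ∀ x ∈ K, x.1 ≠ c u := by
    intro x hx hxu
    have := mk_eq_map (fun x : D × Bool => π x.1) h2 hx
    simp only at this
    rw [hxu] at this
    exact hn this.symm
  have hmem : (u, true) ∈ K := by
    refine mem_of_closed_except (σ := double σ τ) (ρ := closeUp c) (a := (u, false)) rfl
      (fun x hx => ?_) (double_invol hp.left.invol hp.right.invol)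
      (double_ne hp.left.ne hp.right.ne) (fun x hx hxa hxb => ?_) (closeUp_invol hc) closeUp_ne
    · exact (Quot.sound (r := r₀) (Or.inl rfl)).symm.trans hx
    · have hxu : x.1 ≠ u := by
        rcases x with ⟨d, _ | _⟩
        · rintro rfl; exact hxa rfl
        · rintro rfl; exact hxb rfl
      refine ⟨(Quot.sound (r := r₀) (Or.inr ⟨hxu, hKw x hx, rfl⟩)).symm.trans hx, fun h => ?_⟩
      have h' := congrArg (closeUp c) h
      rw [closeUp_invol hc] at h'
      have h'' : x.1 = c u := by rw [h']; simp [closeUp, hu]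
      exact hKw x hx h''
  exact (mk_eq_map id h1 hmem).symm

/-- Euler's inequality for partial matchings of the points. -/
theorem two_mul_numCirc_closeUp_add_le [Finite D] [Finite E] {π : D → E} {σ τ : D → D}
    (hp : TransitionPair π σ τ) {c : D → D} (hc : ∀ d, c (c d) = d) :
    2 * numCirc (closeUp c) (double σ τ) + {d | c d = d}.ncard ≤
      2 * Nat.card E + 4 * numMedial π c := by
  induction hn : {d | c d ≠ d}.ncard using Nat.strong_induction_on generalizing c with
  | _ n ih =>
  by_cases hfix : ∀ d, c d = d
  -- With no medial edges, the eight copies of the points of one edge all lie on a single circuit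
  -- and each edge is its own component.
  · have hcard : {d | c d = d}.ncard = 4 * Nat.card E := by
      rw [← hp.card, ← Set.ncard_univ]; congr 1; ext d; simp [hfix]
    have hk : numMedial π c = Nat.card E := by
      refine le_antisymm (Nat.card_le_card_of_surjective _ Quot.mk_surjective) ?_
      refine Nat.card_le_card_of_surjective (Quot.lift id ?_) fun e => ⟨Quot.mk _ e, rfl⟩
      rintro e e' ⟨d, rfl, rfl⟩
      simp [hfix]
    have hZ : numCirc (closeUp c) (double σ τ) ≤ Nat.card E := by
      set r := Circ (closeUp c) (double σ τ)
      have hcp : ∀ d b, Quot.mk r (d, !b) = Quot.mk r (d, b) := by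
        intro d b
        have := circ_mk_left (c := closeUp c) (σ := double σ τ) (d, b)
        simpa [closeUp, hfix] using this
      have hft : ∀ d b, Quot.mk r (d, b) = Quot.mk r (d, false) := by
        rintro d (_ | _)
        · rfl
        · exact hcp d false
      have hσ' : ∀ d, Quot.mk r (σ d, false) = Quot.mk r (d, false) := by
        intro d
        simpa [double] using circ_mk_right (c := closeUp c) (σ := double σ τ) (d, false)
      have hτ' : ∀ d, Quot.mk r (τ d, false) = Quot.mk r (d, false) := by
        intro d
        have := circ_mk_right (c := closeUp c) (σ := double σ τ) (d, true)
        rw [← hft (τ d) true, ← hft d true]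
        simpa [double] using this
      refine Nat.card_le_card_of_surjective
        (fun e => Quot.mk r ((hp.surj e).choose, false)) fun q => ?_
      induction q using Quot.ind with
      | mk x =>
        rcases x with ⟨d, b⟩
        refine ⟨π d, ?_⟩
        rw [hft d b]
        change Quot.mk r ((hp.surj (π d)).choose, false) = _
        have hspec := (hp.surj (π d)).choose_spec
        generalize (hp.surj (π d)).choose = d' at hspec
        rcases hp.gen d d' hspec.symm with rfl | rfl | rfl | rfl
        · rfl
        · exact hσ' d
        · exact hτ' d
        · exact (hσ' _).trans (hτ' d)
    omega
  · push Not at hfix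
    obtain ⟨u, hu⟩ := hfix
    set c₀ := unpair c u with hc₀
    have hcu : c (c u) = u := hc u
    have hv : ∀ d, d ≠ u → d ≠ c u → c₀ d = c d := by
      intro d h1 h2; simp [hc₀, unpair, h1, h2]
    have hvu : c₀ u = u := by simp [hc₀, unpair]
    have hvw : c₀ (c u) = c u := by simp [hc₀, unpair]
    have hfixed : {d | c₀ d = d}.ncard = {d | c d = d}.ncard + 2 := by
      have : {d | c₀ d = d} = insert u (insert (c u) {d | c d = d}) := by
        ext d
        by_cases h1 : d = u
        · simp [h1, hvu]
        · by_cases h2 : d = c u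
          · simp [h2, hvw]
          · simp [hv d h1 h2, h1, h2]
      rw [this, Set.ncard_insert_of_notMem, Set.ncard_insert_of_notMem]
      · simp [hcu, Ne.symm hu]
      · simp [hu, Ne.symm hu]
    have hlt : {d | c₀ d ≠ d}.ncard < n := by
      rw [← hn]
      have e1 := Set.ncard_add_ncard_compl {d | c₀ d = d}
      have e2 := Set.ncard_add_ncard_compl {d | c d = d}
      have e3 : {d | c₀ d = d}ᶜ = {d | c₀ d ≠ d} := rfl
      have e4 : {d | c d = d}ᶜ = {d | c d ≠ d} := rfl
      rw [e3] at e1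
      rw [e4] at e2
      omega
    have IH := ih _ hlt (c := c₀) (unpair_invol hc u) rfl
    set r := Circ (closeUp c) (double σ τ)
    set r₀ := Circ (closeUp c₀) (double σ τ)
    have huw : ∀ b, Quot.mk r (c u, b) = Quot.mk r (u, b) := by
      intro b
      simpa [closeUp, hu] using circ_mk_left (c := closeUp c) (σ := double σ τ) (u, b)
    have hsame : ∀ x : D × Bool, x.1 ≠ u → x.1 ≠ c u → closeUp c₀ x = closeUp c x := by
      intro x h1 h2; unfold closeUp; rw [hv x.1 h1 h2]
    have hZ : numCirc (closeUp c) (double σ τ) ≤ numCirc (closeUp c₀) (double σ τ) + 1 := by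
      refine card_quot_le_succ (u, false) (u, true) ?_
      have hb : ∀ b, Quot.mk r (u, b) = Quot.mk r (u, false) ∨
          Quot.mk r (u, b) = Quot.mk r (u, true) := by rintro (_ | _) <;> simp
      rintro ⟨d, b⟩ y (rfl | rfl)
      · by_cases h1 : d = u
        · subst h1; right
          simp only [closeUp, hvu, if_true]
          exact ⟨hb _, hb _⟩
        · by_cases h2 : d = c u
          · subst h2; right
            simp only [closeUp, hvw, if_true]
            change (Quot.mk r _ = _ ∨ Quot.mk r _ = _) ∧ (Quot.mk r _ = _ ∨ Quot.mk r _ = _)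
            rw [huw, huw]
            exact ⟨hb _, hb _⟩
          · left
            rw [hsame _ h1 h2]
            exact (circ_mk_left _).symm
      · exact Or.inl (circ_mk_right _).symm
    have hM : ∀ e e', MedialAdj π c e e' → Quot.mk (MedialAdj π c₀) e = Quot.mk (MedialAdj π c₀) e' ∨
        (e = π u ∧ e' = π (c u)) ∨ (e = π (c u) ∧ e' = π u) := by
      rintro e e' ⟨d, rfl, rfl⟩
      by_cases h1 : d = u
      · subst h1; exact Or.inr (Or.inl ⟨rfl, rfl⟩)
      · by_cases h2 : d = c u
        · subst h2; exact Or.inr (Or.inr ⟨rfl, by rw [hcu]⟩)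
        · left
          rw [← hv d h1 h2]; exact (medial_mk d).symm
    -- Restoring a medial edge removes two fixed points. If it is not a bridge, it adds at most one
    -- circuit and merges no components. If it is a bridge, it may merge two components but then
    -- loses a circuit, so both sides drop by four.
    by_cases hk : Quot.mk (MedialAdj π c₀) (π u) = Quot.mk (MedialAdj π c₀) (π (c u))
    · have : numMedial π c₀ ≤ numMedial π c := by
        refine card_quot_le fun e e' h => ?_
        rcases hM e e' h with h | ⟨rfl, rfl⟩ | ⟨rfl, rfl⟩
        · exact h
        · exact hk
        · exact hk.symm
      omega
    · have hk' : numMedial π c₀ ≤ numMedial π c + 1 := by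
        refine card_quot_le_succ (π u) (π (c u)) fun e e' h => ?_
        rcases hM e e' h with h | ⟨rfl, rfl⟩ | ⟨rfl, rfl⟩
        · exact Or.inl h
        · simp
        · simp
      have huu := mk_unpair_left (σ := σ) (τ := τ) hc hp hu hk
      have hbb : ∀ b, Quot.mk r (u, !b) = Quot.mk r (u, b) := by
        rintro (_ | _)
        · exact huu.symm
        · exact huu
      have hZ' : numCirc (closeUp c) (double σ τ) + 1 ≤ numCirc (closeUp c₀) (double σ τ) := by
        refine card_quot_lt ?_ (a := (u, false)) (b := (c u, false)) (huw false).symm ?_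
        · rintro ⟨d, b⟩ y (rfl | rfl)
          · by_cases h1 : d = u
            · subst h1
              simp only [closeUp, hvu, if_true]
              exact (hbb b).symm
            · by_cases h2 : d = c u
              · subst h2
                simp only [closeUp, hvw, if_true]
                exact (huw b).trans ((hbb b).symm.trans (huw (!b)).symm)
              · rw [hsame _ h1 h2]
                exact (circ_mk_left _).symm
          · exact (circ_mk_right _).symm
        · intro h
          exact hk (mk_eq_map (fun x : D × Bool => π x.1) (medial_mk_of_circ hp) h)
      omega

end Euler

end RibbonGraph

namespace RibbonGraph

/-! ### Reconnecting two pairs of a matching -/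

section Surgery

variable {D E : Type*}

theorem mem_of_circ {α : Type*} {c σ : α → α} (hc : ∀ x, c (c x) = x) (hσ : ∀ x, σ (σ x) = x)
    {K : Set α} (hcK : ∀ x ∈ K, c x ∈ K) (hσK : ∀ x ∈ K, σ x ∈ K) {x y : α}
    (h : Quot.mk (Circ c σ) x = Quot.mk (Circ c σ) y) (hx : x ∈ K) : y ∈ K := by
  refine (mem_iff_of_mk_eq ?_ h).1 hx
  rintro x y (rfl | rfl)
  · exact ⟨hcK x, fun h => hc x ▸ hcK _ h⟩
  · exact ⟨hσK x, fun h => hσ x ▸ hσK _ h⟩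

open Classical in
/-- Replace the pairs `{i, c i}` and `{j, c j}` by `{i, j}` and `{c i, c j}`. -/
noncomputable def surgery (c : D → D) (i j d : D) : D :=
  if d = i then j else if d = j then i else if d = c i then c j else if d = c j then c i else c d

/-- `c` is a perfect matching with distinct pairs `{i, c i}` and `{j, c j}`. -/
structure Switchable (c : D → D) (i j : D) : Prop where
  invol : ∀ d, c (c d) = d
  ne : ∀ d, c d ≠ d
  ne_right : i ≠ j
  comp_ne : c i ≠ j

theorem Switchable.comp {c : D → D} {i j : D} (h : Switchable c i j) :
    Switchable c (c i) (c j) where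
  invol := h.invol
  ne := h.ne
  ne_right e := h.ne_right (by rw [← h.invol i, e, h.invol])
  comp_ne e := h.comp_ne (by rw [← h.invol j, ← e, h.invol])

theorem surgery_left {c : D → D} {i j : D} : surgery c i j i = j := by simp [surgery]

theorem surgery_right {c : D → D} {i j : D} : surgery c i j j = i := by simp [surgery]

theorem surgery_of_ne {c : D → D} {i j d : D} (h1 : d ≠ i) (h2 : d ≠ j) (h3 : d ≠ c i)
    (h4 : d ≠ c j) : surgery c i j d = c d := by simp [surgery, h1, h2, h3, h4]

namespace Switchable

variable {c : D → D} {i j : D}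

theorem surgery_comp_left (h : Switchable c i j) : surgery c i j (c i) = c j := by simp [surgery, h.ne, h.comp_ne]

theorem surgery_comp_right (h : Switchable c i j) : surgery c i j (c j) = c i := by
  have h1 : c j ≠ i := fun e => h.comp_ne (by rw [← e, h.invol])
  simp [surgery, h.ne, h1, h.comp.ne_right.symm]

theorem surgery_cases (h : Switchable c i j) {P : D → D → Prop} (h1 : P i j) (h2 : P j i) (h3 : P (c i) (c j))
    (h4 : P (c j) (c i))
    (h5 : ∀ d, d ≠ i → d ≠ j → d ≠ c i → d ≠ c j → P d (c d)) (d : D) :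
    P d (surgery c i j d) := by
  by_cases e1 : d = i
  · rw [e1, surgery_left]; exact h1
  by_cases e2 : d = j
  · rw [e2, surgery_right]; exact h2
  by_cases e3 : d = c i
  · rw [e3, h.surgery_comp_left]; exact h3
  by_cases e4 : d = c j
  · rw [e4, h.surgery_comp_right]; exact h4
  rw [surgery_of_ne e1 e2 e3 e4]
  exact h5 d e1 e2 e3 e4

theorem surgery_invol (h : Switchable c i j) (d : D) : surgery c i j (surgery c i j d) = d := by
  refine h.surgery_cases (P := fun d d' => surgery c i j d' = d) surgery_right
    surgery_left h.surgery_comp_right h.surgery_comp_left ?_ d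
  intro d h1 h2 h3 h4
  rw [surgery_of_ne, h.invol]
  · exact fun e => h3 (by rw [← e, h.invol])
  · exact fun e => h4 (by rw [← e, h.invol])
  · exact fun e => h1 (by rw [← h.invol d, e, h.invol])
  · exact fun e => h2 (by rw [← h.invol d, e, h.invol])

theorem surgery_ne (h : Switchable c i j) (d : D) : surgery c i j d ≠ d :=
  h.surgery_cases (P := fun d d' => d' ≠ d) h.ne_right.symm h.ne_right h.comp.ne_right.symm
    h.comp.ne_right (fun d _ _ _ _ => h.ne d) d

theorem surgery_symm (h : Switchable c i j) : surgery c (c i) (c j) = surgery c i j := by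
  funext d
  refine h.surgery_cases (P := fun d d' => surgery c (c i) (c j) d = d')
    ?_ ?_ surgery_left surgery_right ?_ d
  · simpa [h.invol] using h.comp.surgery_comp_left
  · simpa [h.invol] using h.comp.surgery_comp_right
  · intro d e1 e2 e3 e4
    exact surgery_of_ne e3 e4 (by rwa [h.invol]) (by rwa [h.invol])

end Switchable

/-- A surgery on the two points where a circuit of `c` and `σ` leaves `W` cuts off a circuit, for
each `σ'` that agrees with `σ` on `W`. -/
theorem Switchable.numCirc_succ_le [Finite D] {c σ σ' : D → D} {i j : D} (hs : Switchable c i j)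
    (hσ : ∀ d, σ' (σ' d) = d) (hσn : ∀ d, σ' d ≠ d) {W : Set D}
    (hW : ∀ d ∈ W, σ' d ∈ W) (hag : ∀ d ∈ W, σ' d = σ d) (hi : i ∈ W) (hci : c i ∉ W)
    (hcj : c j ∉ W)
    (hcut : ∀ d ∈ W, c d ∉ W → Quot.mk (Circ c σ) d = Quot.mk (Circ c σ) i → d = i ∨ d = j) :
    numCirc c σ' + 1 ≤ numCirc (surgery c i j) σ' := by
  -- The arc that starts at `i` inside `W` is common to both circuits. Apart from `i`, it can leave
  -- `W` only at `j`, so parity puts `j` on it.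
  have hjK : j ∈ {x | x ∈ W ∧ Quot.mk (Circ c σ') x = Quot.mk (Circ c σ') i ∧
      Quot.mk (Circ c σ) x = Quot.mk (Circ c σ) i} := by
    refine mem_of_closed_except (σ := σ') (ρ := c) (a := i) ⟨hi, rfl, rfl⟩ ?_ hσ hσn ?_ hs.invol
      hs.ne
    · rintro x ⟨h1, h2, h3⟩
      refine ⟨hW x h1, (circ_mk_right x).trans h2, ?_⟩
      rw [hag x h1]
      exact (circ_mk_right x).trans h3
    · rintro x ⟨h1, h2, h3⟩ hxi hxj
      have hcx : c x ∈ W := by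
        by_contra hcx
        rcases hcut x h1 hcx h3 with h | h
        · exact hxi h
        · exact hxj h
      refine ⟨⟨hcx, (circ_mk_left x).trans h2, (circ_mk_left x).trans h3⟩, fun h => hci ?_⟩
      rwa [← h, hs.invol]
  have hji := hjK.2.1
  -- After the surgery every circuit lies in an old one, since `i` and `j` shared a circuit; but the
  -- new circuit of `i` closes up inside `W` and loses `c i`.
  refine card_quot_lt (a := i) (b := c i) ?_ (circ_mk_left i).symm fun h => hci ?_
  · rintro x y (rfl | rfl)
    · refine hs.surgery_cases (P := fun x y => Quot.mk (Circ c σ') x = Quot.mk (Circ c σ') y)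
        hji.symm hji ?_ ?_ ?_ x
      · rw [circ_mk_left, circ_mk_left, hji]
      · rw [circ_mk_left, circ_mk_left, hji]
      · exact fun d _ _ _ _ => (circ_mk_left d).symm
    · exact (circ_mk_right x).symm
  · refine (mem_of_circ hs.surgery_invol hσ
      (K := {x | x ∈ W ∧ Quot.mk (Circ c σ) x = Quot.mk (Circ c σ) i}) ?_ ?_ h ⟨hi, rfl⟩).1
    · intro x
      refine hs.surgery_cases (P := fun x y => x ∈ {x | x ∈ W ∧ Quot.mk (Circ c σ) x =
        Quot.mk (Circ c σ) i} → y ∈ {x | x ∈ W ∧ Quot.mk (Circ c σ) x = Quot.mk (Circ c σ) i})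
        (fun _ => ⟨hjK.1, hjK.2.2⟩) (fun _ => ⟨hi, rfl⟩) (fun h => (hci h.1).elim)
        (fun h => (hcj h.1).elim) ?_ x
      rintro d h1 h2 - - ⟨hd, hd'⟩
      refine ⟨?_, (circ_mk_left d).trans hd'⟩
      by_contra hcd
      rcases hcut d hd hcd hd' with h | h
      · exact h1 h
      · exact h2 h
    · rintro x ⟨h1, h2⟩
      refine ⟨hW x h1, ?_⟩
      rw [hag x h1]
      exact (circ_mk_right x).trans h2

end Surgery

/-! ### Cuts of the medial graph and exchange of transitions -/

section Cuts

variable {D E : Type*} {π : D → E} {c σ τ : D → D}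

/-- The points in `X` that are matched to points outside `X`. -/
def cutPts (π : D → E) (c : D → D) (X : Set E) : Set D := {d | π d ∈ X ∧ π (c d) ∉ X}

theorem even_ncard_cut [Finite D] {W : Set D} (hσ : ∀ d, σ (σ d) = d) (hσn : ∀ d, σ d ≠ d)
    (hc : ∀ d, c (c d) = d) (hcn : ∀ d, c d ≠ d) (hW : ∀ d ∈ W, σ d ∈ W) :
    Even {d | d ∈ W ∧ c d ∉ W}.ncard := by
  have h1 : Even W.ncard := even_ncard_of_involution σ hW (fun d _ => hσ d) (fun d _ => hσn d)
  have h2 : Even {d | d ∈ W ∧ c d ∈ W}.ncard :=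
    even_ncard_of_involution c (fun d hd => ⟨hd.2, by simpa [hc] using hd.1⟩) (fun d _ => hc d)
      (fun d _ => hcn d)
  have h3 := Set.ncard_inter_add_ncard_sdiff_eq_ncard W {d | c d ∈ W} W.toFinite
  have e1 : W ∩ {d | c d ∈ W} = {d | d ∈ W ∧ c d ∈ W} := rfl
  have e2 : W \ {d | c d ∈ W} = {d | d ∈ W ∧ c d ∉ W} := rfl
  rw [e1, e2] at h3
  grind

theorem even_ncard_cutPts [Finite D] (hσ : Transition π σ) (hc : ∀ d, c (c d) = d)
    (hcn : ∀ d, c d ≠ d) (X : Set E) : Even (cutPts π c X).ncard :=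
  even_ncard_cut (W := π ⁻¹' X) hσ.invol hσ.ne hc hcn (fun d hd => by
    rw [Set.mem_preimage, hσ.fiber]; exact hd)

theorem cutPts_compl (hc : ∀ d, c (c d) = d) (X : Set E) : cutPts π c Xᶜ = c '' cutPts π c X := by
  ext d
  constructor
  · rintro ⟨h1, h2⟩
    exact ⟨c d, ⟨not_not.1 h2, by rwa [hc]⟩, hc d⟩
  · rintro ⟨d, ⟨h1, h2⟩, rfl⟩
    exact ⟨h2, by rw [hc]; exact not_not.2 h1⟩

theorem ncard_cutPts_compl (hc : ∀ d, c (c d) = d) (X : Set E) :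
    (cutPts π c Xᶜ).ncard = (cutPts π c X).ncard := by
  rw [cutPts_compl hc, Set.ncard_image_of_injective _ (Function.LeftInverse.injective hc)]

open Classical in
/-- Exchange `σ` for `τ` on the edges in `C`. -/
noncomputable def swapOn (π : D → E) (C : Set E) (σ τ : D → D) (d : D) : D :=
  if π d ∈ C then τ d else σ d

theorem swapOn_of_mem {C : Set E} {d : D} (h : π d ∈ C) : swapOn π C σ τ d = τ d := if_pos h

theorem swapOn_of_notMem {C : Set E} {d : D} (h : π d ∉ C) : swapOn π C σ τ d = σ d := if_neg h

theorem swapOn_swapOn (C : Set E) :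
    swapOn π C (swapOn π C σ τ) (swapOn π C τ σ) = σ := by
  funext d; by_cases h : π d ∈ C <;> simp [swapOn, h]

theorem Transition.swapOn (hσ : Transition π σ) (hτ : Transition π τ) (C : Set E) :
    Transition π (swapOn π C σ τ) where
  invol d := by
    by_cases h : π d ∈ C <;>
      simp [RibbonGraph.swapOn, h, hσ.fiber, hτ.fiber, hσ.invol, hτ.invol]
  ne d := by by_cases h : π d ∈ C <;> simp [RibbonGraph.swapOn, h, hσ.ne, hτ.ne]
  fiber d := by by_cases h : π d ∈ C <;> simp [RibbonGraph.swapOn, h, hσ.fiber, hτ.fiber]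

theorem TransitionPair.symm (hp : TransitionPair π σ τ) : TransitionPair π τ σ where
  left := hp.right
  right := hp.left
  gen d d' h := by
    rw [← hp.comm]
    rcases hp.gen d d' h with h | h | h | h
    · exact Or.inl h
    · exact Or.inr (Or.inr (Or.inl h))
    · exact Or.inr (Or.inl h)
    · exact Or.inr (Or.inr (Or.inr h))
  surj := hp.surj
  comm d := (hp.comm d).symm
  card := hp.card

theorem TransitionPair.swapOn (hp : TransitionPair π σ τ) (C : Set E) :
    TransitionPair π (swapOn π C σ τ) (swapOn π C τ σ) where
  left := hp.left.swapOn hp.right C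
  right := hp.right.swapOn hp.left C
  gen d d' h := by
    by_cases hd : π d ∈ C
    · simpa [RibbonGraph.swapOn, hd, hp.left.fiber] using hp.symm.gen d d' h
    · simpa [RibbonGraph.swapOn, hd, hp.right.fiber] using hp.gen d d' h
  surj := hp.surj
  comm d := by
    by_cases hd : π d ∈ C <;>
      simp [RibbonGraph.swapOn, hd, hp.left.fiber, hp.right.fiber, hp.comm]
  card := hp.card

/-- Without unmatched points the two copies never meet, so `closeUp` keeps the circuits of the two
transitions apart. -/
theorem numCirc_add_le_closeUp [Finite D] (hcn : ∀ d, c d ≠ d) :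
    numCirc c σ + numCirc c τ ≤ numCirc (closeUp c) (double σ τ) := by
  let f : D × Bool → Quot (Circ c σ) ⊕ Quot (Circ c τ) := fun x =>
    if x.2 then Sum.inr (Quot.mk _ x.1) else Sum.inl (Quot.mk _ x.1)
  have hf : ∀ x y, Circ (closeUp c) (double σ τ) x y → f x = f y := by
    rintro ⟨d, _ | _⟩ y (rfl | rfl)
    · simp [f, closeUp, hcn, circ_mk_left]
    · simp [f, double, circ_mk_right]
    · simp [f, closeUp, hcn, circ_mk_left]
    · simp [f, double, circ_mk_right]
  rw [numCirc, numCirc, ← Nat.card_sum]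
  refine Nat.card_le_card_of_surjective (Quot.lift f hf) ?_
  rintro (q | q) <;> induction q using Quot.ind with | mk d => ?_
  · exact ⟨Quot.mk _ (d, false), rfl⟩
  · exact ⟨Quot.mk _ (d, true), rfl⟩

/-- This is Euler's formula as an inequality: `|E|` vertices, `2|E|` edges, the circuits as faces,
and Euler characteristic at most two per component. -/
theorem TransitionPair.numCirc_add_le [Finite D] [Finite E] (hp : TransitionPair π σ τ)
    (hc : ∀ d, c (c d) = d) (hcn : ∀ d, c d ≠ d) :
    numCirc c σ + numCirc c τ ≤ Nat.card E + 2 * numMedial π c := by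
  have h1 := numCirc_add_le_closeUp (σ := σ) (τ := τ) hcn
  have h2 := two_mul_numCirc_closeUp_add_le hp hc
  omega

/-- If surgery does not leave `X`, then `c` can leave it only along the two altered pairs, at one
point of each. -/
theorem ncard_cut_le_two {i j : D} (hs : Switchable c i j) {X : Set E}
    (hX : ∀ d, π d ∈ X → π (surgery c i j d) ∈ X) : (cutPts π c X).ncard ≤ 2 := by
  classical
  have hsub : cutPts π c X ⊆ {if π i ∈ X then i else c i, if π j ∈ X then j else c j} := by
    rintro d ⟨h1, h2⟩
    by_cases e1 : d = i
    · subst e1; simp [h1]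
    by_cases e2 : d = j
    · subst e2; simp [h1]
    by_cases e3 : d = c i
    · subst e3; rw [hs.invol] at h2; simp [h2]
    by_cases e4 : d = c j
    · subst e4; rw [hs.invol] at h2; simp [h2]
    have := hX d h1
    rw [surgery_of_ne e1 e2 e3 e4] at this
    exact (h2 this).elim
  refine (Set.ncard_le_ncard hsub (Set.toFinite _)).trans ?_
  exact (Set.ncard_insert_le _ _).trans (by simp)

/-- Without small cuts, circuits that meet the boundary of `C` do so often. -/
theorem eight_le_ncard_circuit [Finite D] [Finite E] (hp : TransitionPair π σ τ)
    (hc : ∀ d, c (c d) = d) (hcn : ∀ d, c d ≠ d) (C : Set E)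
    (hno : ∀ X : Set E, (cutPts π c X).ncard ≤ 2 → cutPts π c X = ∅)
    (hf : Nat.card E + 2 * numMedial π c ≤
      numCirc c (swapOn π C σ τ) + numCirc c (swapOn π C τ σ) + 1) {u : D}
    (hu : ¬ (π u ∈ C ↔ π (c u) ∈ C)) :
    8 ≤ {d | ¬ (π d ∈ C ↔ π (c d) ∈ C) ∧ Quot.mk (Circ c σ) d = Quot.mk (Circ c σ) u}.ncard := by
  set K := {d | Quot.mk (Circ c σ) d = Quot.mk (Circ c σ) u} with hK
  have hcK : ∀ d, c d ∈ K ↔ d ∈ K := fun d => by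
    simp only [hK, Set.mem_ofPred_eq, circ_mk_left]
  have hσK : ∀ d, σ d ∈ K ↔ d ∈ K := fun d => by
    simp only [hK, Set.mem_ofPred_eq, circ_mk_right]
  have heven : Even (cutPts π c C ∩ K).ncard := by
    have := even_ncard_cut (W := {d | π d ∈ C ∧ d ∈ K}) hp.left.invol hp.left.ne hc hcn
      (fun d hd => ⟨by rw [hp.left.fiber]; exact hd.1, (hσK d).2 hd.2⟩)
    convert this using 2
    ext d
    simp only [cutPts, Set.mem_inter_iff, Set.mem_ofPred_eq, hcK]
    tauto
  have hcompl : (cutPts π c Cᶜ ∩ K).ncard = (cutPts π c C ∩ K).ncard := by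
    have : cutPts π c Cᶜ ∩ K = c '' (cutPts π c C ∩ K) := by
      rw [cutPts_compl hc]
      ext d
      constructor
      · rintro ⟨⟨d, hd, rfl⟩, h⟩
        exact ⟨d, ⟨hd, (hcK d).1 h⟩, rfl⟩
      · rintro ⟨d, ⟨hd, h⟩, rfl⟩
        exact ⟨⟨d, hd, rfl⟩, (hcK d).2 h⟩
    rw [this, Set.ncard_image_of_injective _ (Function.LeftInverse.injective hc)]
  have hunion : {d | ¬ (π d ∈ C ↔ π (c d) ∈ C) ∧ Quot.mk (Circ c σ) d = Quot.mk (Circ c σ) u} =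
      (cutPts π c C ∩ K) ∪ (cutPts π c Cᶜ ∩ K) := by
    ext d
    simp only [cutPts, hK, Set.mem_inter_iff, Set.mem_union, Set.mem_ofPred_eq, Set.mem_compl_iff]
    tauto
  have hdisj : Disjoint (cutPts π c C ∩ K) (cutPts π c Cᶜ ∩ K) :=
    Set.disjoint_left.2 fun d h1 h2 => h2.1.1 h1.1.1
  have hsum := Set.ncard_union_eq hdisj
  rw [← hunion] at hsum
  have hpos : (cutPts π c C ∩ K).ncard ≠ 0 := by
    intro h0
    have h0' : {d | ¬ (π d ∈ C ↔ π (c d) ∈ C) ∧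
        Quot.mk (Circ c σ) d = Quot.mk (Circ c σ) u}.ncard = 0 := by omega
    rw [Set.ncard_eq_zero] at h0'
    exact (h0' ▸ (⟨hu, rfl⟩ : u ∈ {d | ¬ (π d ∈ C ↔ π (c d) ∈ C) ∧
        Quot.mk (Circ c σ) d = Quot.mk (Circ c σ) u}) : u ∈ (∅ : Set D))
  -- A circuit crossing exactly twice consists of one arc in `C` and one outside. Each exchanged
  -- pairing agrees with `σ` on one of these sides, so the surgery closing both arcs cuts off a
  -- circuit from each exchanged system.
  have htwo : (cutPts π c C ∩ K).ncard ≠ 2 := by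
    intro h2
    obtain ⟨i, j, hij, hS⟩ := Set.ncard_eq_two.1 h2
    have hi : i ∈ cutPts π c C ∩ K := hS ▸ Set.mem_insert i {j}
    have hj : j ∈ cutPts π c C ∩ K := hS ▸ Set.mem_insert_of_mem i rfl
    have hs : Switchable c i j := ⟨hc, hcn, hij, fun h => hi.1.2 (h ▸ hj.1.1)⟩
    have hcut : ∀ d, d ∈ cutPts π c C → Quot.mk (Circ c σ) d = Quot.mk (Circ c σ) i →
        d = i ∨ d = j := by
      intro d hd hdi
      have : d ∈ cutPts π c C ∩ K := ⟨hd, hdi.trans hi.2⟩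
      rw [hS] at this
      simpa using this
    have f1 : numCirc c (swapOn π C τ σ) + 1 ≤ numCirc (surgery c i j) (swapOn π C τ σ) := by
      have ht := hp.right.swapOn hp.left C
      refine hs.numCirc_succ_le (σ := σ) ht.invol ht.ne (W := π ⁻¹' C) ?_ ?_ hi.1.1 hi.1.2 hj.1.2
        (fun d hd hcd => hcut d ⟨hd, hcd⟩)
      · intro d hd; rw [Set.mem_preimage, ht.fiber]; exact hd
      · intro d hd; exact swapOn_of_mem hd
    have f2 : numCirc c (swapOn π C σ τ) + 1 ≤ numCirc (surgery c i j) (swapOn π C σ τ) := by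
      have ht := hp.left.swapOn hp.right C
      rw [← hs.surgery_symm]
      refine hs.comp.numCirc_succ_le (σ := σ) ht.invol ht.ne (W := π ⁻¹' Cᶜ) ?_ ?_ hi.1.2
        (by rw [hc]; exact not_not.2 hi.1.1) (by rw [hc]; exact not_not.2 hj.1.1) ?_
      · intro d hd; rw [Set.mem_preimage, ht.fiber]; exact hd
      · intro d hd; exact swapOn_of_notMem hd
      · intro d hd hcd hdi
        rw [circ_mk_left] at hdi
        rcases hcut (c d) ⟨not_not.1 hcd, by rwa [hc]⟩ ((circ_mk_left d).trans hdi) with h | h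
        · left; rw [← h, hc]
        · right; rw [← h, hc]
    -- Two extra circuits exceed what genus at most one leaves available, so the surgery must have
    -- disconnected a component; the pieces are then separated by a small non-empty cut.
    have hE := (hp.swapOn C).numCirc_add_le hs.surgery_invol hs.surgery_ne
    have hk : ¬ (numMedial π (surgery c i j) ≤ numMedial π c) := by omega
    apply hk
    refine card_quot_le ?_
    rintro e e' ⟨d, rfl, rfl⟩
    by_contra hne
    let X : Set E := {e | Quot.mk (MedialAdj π (surgery c i j)) e =
      Quot.mk (MedialAdj π (surgery c i j)) (π d)}
    have hX := hno X (ncard_cut_le_two hs fun d' hd' => (medial_mk d').trans hd')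
    exact (hX ▸ (⟨rfl, fun h => hne h.symm⟩ : d ∈ cutPts π c X) : d ∈ (∅ : Set D))
  grind

end Cuts

end RibbonGraph

namespace RibbonGraph

/-! ### Separating the two sides of the exchanged set -/

section Separation

variable {D E : Type*} {π : D → E} {c σ τ : D → D}

open Classical in
/-- Unmatch the points that are matched across the boundary of `C`. -/
noncomputable def separate (π : D → E) (c : D → D) (C : Set E) (d : D) : D :=
  if π d ∈ C ↔ π (c d) ∈ C then c d else d

theorem separate_of_iff {C : Set E} {d : D} (h : π d ∈ C ↔ π (c d) ∈ C) :
    separate π c C d = c d := if_pos h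

theorem separate_of_not_iff {C : Set E} {d : D} (h : ¬ (π d ∈ C ↔ π (c d) ∈ C)) :
    separate π c C d = d := if_neg h

theorem separate_invol (hc : ∀ d, c (c d) = d) (C : Set E) (d : D) :
    separate π c C (separate π c C d) = d := by
  by_cases h : π d ∈ C ↔ π (c d) ∈ C
  · rw [separate_of_iff h, separate_of_iff (by rw [hc]; exact h.symm), hc]
  · rw [separate_of_not_iff h, separate_of_not_iff h]

theorem medialAdj_symm (hc : ∀ d, c (c d) = d) (e e' : E) (h : MedialAdj π c e e') :
    MedialAdj π c e' e := by
  obtain ⟨d, rfl, rfl⟩ := h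
  exact ⟨c d, rfl, by rw [hc]⟩

/-- Double counting over both copies: each circuit meeting the doubled `U`, which has `2|U|` points,
uses at least eight of them. -/
theorem eight_mul_ncard_meeting_le [Finite D] (hcn : ∀ d, c d ≠ d) {U : Set D}
    (h1 : ∀ u ∈ U, 8 ≤ {d | d ∈ U ∧ Quot.mk (Circ c σ) d = Quot.mk (Circ c σ) u}.ncard)
    (h2 : ∀ u ∈ U, 8 ≤ {d | d ∈ U ∧ Quot.mk (Circ c τ) d = Quot.mk (Circ c τ) u}.ncard) :
    8 * (Quot.mk (Circ (closeUp c) (double σ τ)) '' (Prod.fst ⁻¹' U)).ncard ≤ 2 * U.ncard := by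
  have hU : (Prod.fst ⁻¹' U : Set (D × Bool)).ncard = 2 * U.ncard := by
    have : (Prod.fst ⁻¹' U : Set (D × Bool)) = U ×ˢ Set.univ := by ext; simp
    rw [this, Set.ncard_prod, Set.ncard_univ, Nat.card_eq_fintype_card, Fintype.card_bool, mul_comm]
  rw [← hU]
  refine mul_ncard_image_le _ _ 8 ?_
  rintro ⟨u, b⟩ hu
  have hinj : Function.Injective fun d : D => (d, b) := fun d d' h => (Prod.mk.inj h).1
  cases b
  · refine (h1 u hu).trans ?_
    rw [← Set.ncard_image_of_injective _ hinj]
    refine Set.ncard_le_ncard ?_ (Set.toFinite _)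
    rintro _ ⟨d, ⟨hd, hd'⟩, rfl⟩
    refine ⟨hd, mk_eq_map (fun d => (d, false)) ?_ hd'⟩
    rintro x y (rfl | rfl)
    · exact Quot.sound (Or.inl (by simp [closeUp, hcn]))
    · exact Quot.sound (Or.inr (by simp [double]))
  · refine (h2 u hu).trans ?_
    rw [← Set.ncard_image_of_injective _ hinj]
    refine Set.ncard_le_ncard ?_ (Set.toFinite _)
    rintro _ ⟨d, ⟨hd, hd'⟩, rfl⟩
    refine ⟨hd, mk_eq_map (fun d => (d, true)) ?_ hd'⟩
    rintro x y (rfl | rfl)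
    · exact Quot.sound (Or.inl (by simp [closeUp, hcn]))
    · exact Quot.sound (Or.inr (by simp [double]))

open Classical in
/-- Exchange the two copies of the points on the edges in `C`. -/
noncomputable def exchange (π : D → E) (C : Set E) : D × Bool ≃ D × Bool where
  toFun x := (x.1, if π x.1 ∈ C then !x.2 else x.2)
  invFun x := (x.1, if π x.1 ∈ C then !x.2 else x.2)
  left_inv x := by by_cases h : π x.1 ∈ C <;> simp [h]
  right_inv x := by by_cases h : π x.1 ∈ C <;> simp [h]

theorem exchange_double (hp : TransitionPair π σ τ) (C : Set E) (x : D × Bool) :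
    exchange π C (double (swapOn π C σ τ) (swapOn π C τ σ) x) = double σ τ (exchange π C x) := by
  rcases x with ⟨d, b⟩
  by_cases h : π d ∈ C <;> cases b <;>
    simp [exchange, double, swapOn, h, hp.left.fiber, hp.right.fiber]

theorem exchange_closeUp (hcn : ∀ d, c d ≠ d) (C : Set E) {x : D × Bool}
    (hx : π x.1 ∈ C ↔ π (c x.1) ∈ C) :
    exchange π C (closeUp c x) = closeUp (separate π c C) (exchange π C x) := by
  rcases x with ⟨d, b⟩
  by_cases h : π d ∈ C
  · simp [exchange, closeUp, separate_of_iff hx, hcn, h, hx.1 h]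
  · simp [exchange, closeUp, separate_of_iff hx, hcn, h, mt hx.2 h]

/-- Cut all medial edges that cross the boundary of `C` and compare circuits and components before
and after. Crossing circuits are too few, and the resulting components have too many loose ends
each, for Euler's inequality to hold. -/
theorem cutPts_eq_empty_of_no_small_cut [Finite D] [Finite E] (hp : TransitionPair π σ τ)
    (hc : ∀ d, c (c d) = d) (hcn : ∀ d, c d ≠ d) (C : Set E)
    (hno : ∀ X : Set E, (cutPts π c X).ncard ≤ 2 → cutPts π c X = ∅)
    (hf : Nat.card E + 2 * numMedial π c ≤ numCirc c σ + numCirc c τ + 1)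
    (hf' : Nat.card E + 2 * numMedial π c ≤
      numCirc c (swapOn π C σ τ) + numCirc c (swapOn π C τ σ) + 1) :
    cutPts π c C = ∅ := by
  by_contra hne
  obtain ⟨u₀, hu₀⟩ := Set.nonempty_iff_ne_empty.2 hne
  set U : Set D := {d | ¬ (π d ∈ C ↔ π (c d) ∈ C)} with hUdef
  set c' := separate π c C with hc'
  have hfp : {d | c' d = d} = U := by
    ext d
    by_cases h : π d ∈ C ↔ π (c d) ∈ C
    · simp [hc', hUdef, separate_of_iff h, hcn, h]
    · simp [hc', hUdef, separate_of_not_iff h, h]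
  have hE := two_mul_numCirc_closeUp_add_le hp (separate_invol (π := π) hc C)
  rw [← hc', hfp] at hE
  have hs := hp.swapOn C
  have hCC := swapOn_swapOn (π := π) (σ := σ) (τ := τ) C
  have hCC' := swapOn_swapOn (π := π) (σ := τ) (τ := σ) C
  have m0 := eight_mul_ncard_meeting_le (σ := σ) (τ := τ) hcn (U := U)
    (fun u hu => eight_le_ncard_circuit hp hc hcn C hno hf' hu)
    (fun u hu => eight_le_ncard_circuit hp.symm hc hcn C hno (by omega) hu)
  have m1 := eight_mul_ncard_meeting_le (σ := swapOn π C σ τ) (τ := swapOn π C τ σ) hcn (U := U)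
    (fun u hu => eight_le_ncard_circuit hs hc hcn C hno (by rw [hCC, hCC']; exact hf) hu)
    (fun u hu => eight_le_ncard_circuit hs.symm hc hcn C hno (by rw [hCC, hCC']; omega) hu)
  have z0 := card_quot_eq_add (Circ (closeUp c) (double σ τ)) (Prod.fst ⁻¹' U)
  have z1 := card_quot_eq_add
    (Circ (closeUp c) (double (swapOn π C σ τ) (swapOn π C τ σ))) (Prod.fst ⁻¹' U)
  have z2 := card_quot_eq_add (Circ (closeUp c') (double σ τ)) (Prod.fst ⁻¹' U)
  have k0 := card_quot_eq_add (MedialAdj π c) (π '' U)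
  have k2 := card_quot_eq_add (MedialAdj π c') (π '' U)
  have hsymm := circ_symm (closeUp_invol (separate_invol (π := π) hc C))
    (double_invol hp.left.invol hp.right.invol)
  have a0 := ncard_avoiding_le (r := Circ (closeUp c) (double σ τ))
    (r' := Circ (closeUp c') (double σ τ)) (U := Prod.fst ⁻¹' U) (Equiv.refl _) (fun _ => Iff.rfl)
    hsymm (by
      rintro ⟨d, b⟩ y hx (h | h)
      · have hx' : π d ∈ C ↔ π (c d) ∈ C := not_not.1 hx
        left
        have hcd : c' d = c d := separate_of_iff hx'
        have hcl : closeUp c' (d, b) = closeUp c (d, b) := by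
          unfold closeUp
          dsimp only
          rw [hcd]
        exact h.trans hcl
      · exact Or.inr h)
  have a1 := ncard_avoiding_le
    (r := Circ (closeUp c) (double (swapOn π C σ τ) (swapOn π C τ σ)))
    (r' := Circ (closeUp c') (double σ τ)) (U := Prod.fst ⁻¹' U) (exchange π C)
    (fun _ => Iff.rfl) hsymm (by
      rintro x y hx (h | h)
      · have hx' : π x.1 ∈ C ↔ π (c x.1) ∈ C := not_not.1 hx
        rw [← exchange_closeUp hcn C hx'] at h
        exact Or.inl ((exchange π C).injective h)
      · rw [← exchange_double hp] at h
        exact Or.inr ((exchange π C).injective h))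
  have a2 := ncard_avoiding_le (r := MedialAdj π c') (r' := MedialAdj π c) (U := π '' U)
    (Equiv.refl _) (fun _ => Iff.rfl) (medialAdj_symm hc) (by
      rintro e e' he ⟨d, h1, h2⟩
      have hd : π d ∈ C ↔ π (c d) ∈ C := by
        by_contra hd
        exact he ⟨d, hd, h1⟩
      exact ⟨d, h1, by rwa [hc', separate_of_iff hd]⟩)
  have meet2 : (Quot.mk (MedialAdj π c') '' (π '' U)).ncard ≤
      (Quot.mk (Circ (closeUp c') (double σ τ)) '' (Prod.fst ⁻¹' U)).ncard := by
    have : Quot.mk (MedialAdj π c') '' (π '' U) =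
        Quot.lift (fun x : D × Bool => Quot.mk (MedialAdj π c') (π x.1)) (medial_mk_of_circ hp) ''
          (Quot.mk (Circ (closeUp c') (double σ τ)) '' (Prod.fst ⁻¹' U)) := by
      ext q
      constructor
      · rintro ⟨_, ⟨d, hd, rfl⟩, rfl⟩
        exact ⟨_, ⟨(d, false), hd, rfl⟩, rfl⟩
      · rintro ⟨_, ⟨x, hx, rfl⟩, rfl⟩
        exact ⟨_, ⟨x.1, hx, rfl⟩, rfl⟩
    rw [this]
    exact Set.ncard_image_le (Set.toFinite _)
  have hmeet : 0 < (Quot.mk (MedialAdj π c) '' (π '' U)).ncard :=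
    (Set.ncard_pos (Set.toFinite _)).2 ⟨_, _, ⟨u₀, fun h => hu₀.2 (h.1 hu₀.1), rfl⟩, rfl⟩
  -- A component of the separated graph lies on one side of `C`, so its cut points under `c` are
  -- exactly its points of `U`. Their number is even, positive and not two.
  have four : 4 * (Quot.mk (MedialAdj π c') '' (π '' U)).ncard ≤ U.ncard := by
    rw [Set.image_image]
    refine mul_ncard_image_le (fun d => Quot.mk (MedialAdj π c') (π d)) U 4 fun u hu => ?_
    let X : Set E := {e | Quot.mk (MedialAdj π c') e = Quot.mk (MedialAdj π c') (π u)}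
    have hside : ∀ e e', Quot.mk (MedialAdj π c') e = Quot.mk (MedialAdj π c') e' →
        (e ∈ C ↔ e' ∈ C) := by
      intro e e' h
      refine mem_iff_of_mk_eq ?_ h
      rintro _ _ ⟨d, rfl, rfl⟩
      by_cases hd : π d ∈ C ↔ π (c d) ∈ C
      · rwa [hc', separate_of_iff hd]
      · rw [hc', separate_of_not_iff hd]
    have hX : cutPts π c X =
        {d | d ∈ U ∧ Quot.mk (MedialAdj π c') (π d) = Quot.mk (MedialAdj π c') (π u)} := by
      ext d
      constructor
      · rintro ⟨h1, h2⟩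
        refine ⟨fun hd => h2 ?_, h1⟩
        have := medial_mk (π := π) (c := c') d
        rw [hc', separate_of_iff hd] at this
        exact this.trans h1
      · rintro ⟨hd, h1⟩
        refine ⟨h1, fun h2 => hd (hside _ _ (h1.trans h2.symm))⟩
    rw [← hX]
    have hev := even_ncard_cutPts hp.left hc hcn X
    have hpos : cutPts π c X ≠ ∅ := by
      rw [hX]
      exact Set.nonempty_iff_ne_empty.1 ⟨u, hu, rfl⟩
    have h2 : ¬ (cutPts π c X).ncard ≤ 2 := fun h => hpos (hno X h)
    grind
  have c0 := numCirc_add_le_closeUp (σ := σ) (τ := τ) hcn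
  have c1 := numCirc_add_le_closeUp (σ := swapOn π C σ τ) (τ := swapOn π C τ σ) hcn
  -- At most `|U|/4` of the original circuits meet `U`, and the rest survive separation, which
  -- bounds `Z'`, the new circuit count, from below. In `hE` each new component meeting `U` costs
  -- four on the right; half of that is paid by `meet2` and half by `four`, while `hmeet` says at
  -- least one old component met `U` and has been replaced. This leaves a contradiction.
  unfold numCirc at *
  unfold numMedial at *
  omega

/-! ### Sets generated by small cuts, and induction by surgery -/

/-- The sets of edges generated, under symmetric difference, by those with at most two boundary
points. -/
inductive CutGenerated (π : D → E) (c : D → D) : Set E → Prop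
  | cut (X : Set E) (h : (cutPts π c X).ncard ≤ 2) : CutGenerated π c X
  | symmDiff (X Y : Set E) (hX : CutGenerated π c X) (hY : CutGenerated π c Y) :
      CutGenerated π c (symmDiff X Y)

/-- Inside `X` the surgery adds only the edge from `i` to `j`. Unless both its ends are in `Y`,
every cut point of `Y ∩ X` is a cut point of `Y` after the surgery. -/
theorem ncard_cutPts_inter_le [Finite D] {i j : D} {X : Set E} (hs : Switchable c i j)
    (hcut : cutPts π c X = {i, j}) {Y : Set E} (hY : (cutPts π (surgery c i j) Y).ncard ≤ 2)
    (hij : ¬ (π i ∈ Y ∧ π j ∈ Y)) : (cutPts π c (Y ∩ X)).ncard ≤ 2 := by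
  refine (Set.ncard_le_ncard ?_ (Set.toFinite _)).trans hY
  have hi : i ∈ cutPts π c X := by rw [hcut]; simp
  have hj : j ∈ cutPts π c X := by rw [hcut]; simp
  rintro d ⟨⟨h1, h2⟩, h3⟩
  refine ⟨h1, fun h4 => ?_⟩
  by_cases e1 : d = i
  · subst e1
    rw [surgery_left] at h4
    exact hij ⟨h1, h4⟩
  by_cases e2 : d = j
  · subst e2
    rw [surgery_right] at h4
    exact hij ⟨h4, h1⟩
  have e3 : d ≠ c i := by rintro rfl; exact hi.2 h2
  have e4 : d ≠ c j := by rintro rfl; exact hj.2 h2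
  rw [surgery_of_ne e1 e2 e3 e4] at h4
  refine h3 ⟨h4, ?_⟩
  by_contra h5
  have : d ∈ cutPts π c X := ⟨h2, h5⟩
  rw [hcut] at this
  rcases this with h | h
  · exact e1 h
  · exact e2 h

/-- When `Y` contains both ends of the new edge, its complement contains neither, and `Y ∩ X` is the
symmetric difference of the small cut `X` with `Yᶜ ∩ X`. -/
theorem CutGenerated.inter_of_surgery [Finite D] {i j : D} {X : Set E} (hs : Switchable c i j)
    (hcut : cutPts π c X = {i, j}) {Y : Set E} (hY : (cutPts π (surgery c i j) Y).ncard ≤ 2) :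
    CutGenerated π c (Y ∩ X) := by
  by_cases hij : π i ∈ Y ∧ π j ∈ Y
  · have h1 : CutGenerated π c X := .cut X (by rw [hcut]; exact (Set.ncard_insert_le _ _).trans (by simp))
    have h2 : CutGenerated π c (Yᶜ ∩ X) := by
      refine .cut _ (ncard_cutPts_inter_le hs hcut ?_ fun h => h.1 hij.1)
      rwa [ncard_cutPts_compl hs.surgery_invol]
    convert CutGenerated.symmDiff _ _ h1 h2 using 1
    ext e
    simp only [Set.mem_inter_iff, Set.mem_symmDiff, Set.mem_compl_iff]
    tauto
  · exact .cut _ (ncard_cutPts_inter_le hs hcut hY hij)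

/-- A small cut after surgery is split along `X`. The two sides are treated alike, because surgery
at `i`, `j` is also surgery at `c i`, `c j`. -/
theorem CutGenerated.of_surgery [Finite D] {i j : D} {X : Set E} (hs : Switchable c i j)
    (hcut : cutPts π c X = {i, j}) {Y : Set E} (hY : CutGenerated π (surgery c i j) Y) :
    CutGenerated π c Y := by
  induction hY with
  | symmDiff Y Z _ _ hY hZ => exact .symmDiff Y Z hY hZ
  | cut Y hY =>
    have h1 := CutGenerated.inter_of_surgery hs hcut hY
    have h2 : CutGenerated π c (Y ∩ Xᶜ) := by
      refine CutGenerated.inter_of_surgery hs.comp ?_ (by rwa [hs.surgery_symm])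
      rw [cutPts_compl hs.invol, hcut, Set.image_pair]
    convert CutGenerated.symmDiff _ _ h1 h2 using 1
    ext e
    simp only [Set.mem_inter_iff, Set.mem_symmDiff, Set.mem_compl_iff]
    tauto

/-- Surgery along a cut with two points splits a circuit. -/
theorem Transition.numCirc_succ_le_of_cut [Finite D] (hσ : Transition π σ) {i j : D} {X : Set E}
    (hs : Switchable c i j) (hcut : cutPts π c X = {i, j}) :
    numCirc c σ + 1 ≤ numCirc (surgery c i j) σ := by
  have hi : i ∈ cutPts π c X := by rw [hcut]; simp
  have hj : j ∈ cutPts π c X := by rw [hcut]; simp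
  refine hs.numCirc_succ_le (σ := σ) hσ.invol hσ.ne (W := π ⁻¹' X) ?_ (fun _ _ => rfl) hi.1 hi.2
    hj.2 fun d h1 h2 _ => ?_
  · intro d hd; rw [Set.mem_preimage, hσ.fiber]; exact hd
  · have : d ∈ cutPts π c X := ⟨h1, h2⟩
    rw [hcut] at this
    simpa using this

/-- The surgery links `i` with `j` and `c i` with `c j`, so the discarded pairs could only join the
classes of `π i` and `π (c i)`. -/
theorem numMedial_surgery_le [Finite E] {i j : D} (hs : Switchable c i j) :
    numMedial π (surgery c i j) ≤ numMedial π c + 1 := by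
  have e1 : Quot.mk (MedialAdj π (surgery c i j)) (π j) =
      Quot.mk (MedialAdj π (surgery c i j)) (π i) := by
    have := medial_mk (π := π) (c := surgery c i j) i
    rwa [surgery_left] at this
  have e2 : Quot.mk (MedialAdj π (surgery c i j)) (π (c j)) =
      Quot.mk (MedialAdj π (surgery c i j)) (π (c i)) := by
    have := medial_mk (π := π) (c := surgery c i j) (c i)
    rwa [hs.surgery_comp_left] at this
  refine card_quot_le_succ (π i) (π (c i)) ?_
  rintro _ _ ⟨d, rfl, rfl⟩
  by_cases h1 : d = i
  · subst h1; simp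
  by_cases h2 : d = j
  · subst h2; simp [e1, e2]
  by_cases h3 : d = c i
  · subst h3; simp [hs.invol]
  by_cases h4 : d = c j
  · subst h4; simp [hs.invol, e1, e2]
  have := medial_mk (π := π) (c := surgery c i j) d
  rw [surgery_of_ne h1 h2 h3 h4] at this
  exact Or.inl this.symm

/-- If exchanging two transitions on `C` preserves the property of having Euler genus at most one,
then `C` is generated by small cuts. -/
theorem TransitionPair.cutGenerated [Finite D] [Finite E] (hp : TransitionPair π σ τ) (C : Set E)
    (hc : ∀ d, c (c d) = d) (hcn : ∀ d, c d ≠ d)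
    (hf : Nat.card E + 2 * numMedial π c ≤ numCirc c σ + numCirc c τ + 1)
    (hf' : Nat.card E + 2 * numMedial π c ≤
      numCirc c (RibbonGraph.swapOn π C σ τ) + numCirc c (RibbonGraph.swapOn π C τ σ) + 1) :
    CutGenerated π c C := by
  -- Surgery strictly increases the number of circuits, which never exceeds the number of points.
  induction hn : Nat.card D - numCirc c σ using Nat.strong_induction_on generalizing c with
  | _ n ih =>
  by_cases hno : ∀ X : Set E, (cutPts π c X).ncard ≤ 2 → cutPts π c X = ∅
  · refine .cut C ?_
    rw [cutPts_eq_empty_of_no_small_cut hp hc hcn C hno hf hf']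
    simp
  · push Not at hno
    obtain ⟨X, hX, hXne⟩ := hno
    have hev := even_ncard_cutPts hp.left hc hcn X
    have hpos := (Set.ncard_pos (Set.toFinite _)).2 hXne
    have h2 : (cutPts π c X).ncard = 2 := by grind
    obtain ⟨i, j, hij, hcut⟩ := Set.ncard_eq_two.1 h2
    have hi : i ∈ cutPts π c X := by rw [hcut]; simp
    have hj : j ∈ cutPts π c X := by rw [hcut]; simp
    have hs : Switchable c i j := ⟨hc, hcn, hij, fun h => hi.2 (h ▸ hj.1)⟩
    have g1 := hp.left.numCirc_succ_le_of_cut hs hcut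
    have g2 := hp.right.numCirc_succ_le_of_cut hs hcut
    have g3 := (hp.swapOn C).left.numCirc_succ_le_of_cut hs hcut
    have g4 := (hp.swapOn C).right.numCirc_succ_le_of_cut hs hcut
    have gk := numMedial_surgery_le (π := π) hs
    have hle : numCirc (surgery c i j) σ ≤ Nat.card D :=
      Nat.card_le_card_of_surjective _ Quot.mk_surjective
    refine CutGenerated.of_surgery hs hcut (ih _ ?_ hs.surgery_invol hs.surgery_ne ?_ ?_ rfl)
    -- In both genus hypotheses the right side gains at least two from the two circuit counts, and
    -- the left at most two from one new component.
    all_goals omega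

end Separation

end RibbonGraph

/-! ### Components of ribbon subgraphs and the sum of Euler genera -/

namespace RibbonGraph

variable {V E : Type*} {G : RibbonGraph V E}

namespace Subgraph

theorem Adj.symm {H : G.Subgraph} {v w : V} (h : H.Adj v w) : H.Adj w v := by
  obtain ⟨e, he, b, h1, h2⟩ := h
  exact ⟨e, he, !b, h2, by simpa using h1⟩

theorem reachable_symm {H : G.Subgraph} {v w : V} (h : Relation.ReflTransGen H.Adj v w) :
    Relation.ReflTransGen H.Adj w v := by
  have : Std.Symm H.Adj := ⟨fun _ _ => Adj.symm⟩
  exact symm_of (Relation.ReflTransGen H.Adj) h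

theorem le_antisymm' {H K : G.Subgraph} (h1 : H ≤ K) (h2 : K ≤ H) : H = K :=
  Subgraph.ext (Set.Subset.antisymm h1.1 h2.1) (Set.Subset.antisymm h1.2 h2.2)

/-- The component of `K` at the vertex `v`. -/
def compOf (K : G.Subgraph) (v : V) : G.Subgraph where
  verts := {w | w ∈ K.verts ∧ Relation.ReflTransGen K.Adj v w}
  edges := {e | e ∈ K.edges ∧ ∀ b, Relation.ReflTransGen K.Adj v (G.vtx (e, b))}
  ends_mem e he b := ⟨K.ends_mem e he.1 b, he.2 b⟩

theorem mem_edges_compOf {K : G.Subgraph} {v : V} {e : E} {b : Bool} (he : e ∈ K.edges)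
    (h : Relation.ReflTransGen K.Adj v (G.vtx (e, b))) : e ∈ (K.compOf v).edges := by
  refine ⟨he, fun b' => ?_⟩
  by_cases hb : b' = b
  · exact hb ▸ h
  · obtain rfl : b' = !b := by cases b <;> cases b' <;> simp_all
    exact h.tail ⟨e, he, b, rfl, rfl⟩

theorem compOf_le (K : G.Subgraph) (v : V) : K.compOf v ≤ K := ⟨fun _ h => h.1, fun _ h => h.1⟩

theorem mem_compOf {K : G.Subgraph} {v : V} (hv : v ∈ K.verts) : v ∈ (K.compOf v).verts :=
  ⟨hv, .refl⟩

theorem connected_compOf {K : G.Subgraph} {v : V} (hv : v ∈ K.verts) :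
    (K.compOf v).Connected := by
  have key : ∀ w, Relation.ReflTransGen K.Adj v w →
      Relation.ReflTransGen (K.compOf v).Adj v w := by
    intro w hw
    induction hw with
    | refl => exact .refl
    | tail hw hadj ih =>
      obtain ⟨e, he, b, rfl, rfl⟩ := hadj
      exact ih.tail ⟨e, mem_edges_compOf he hw, b, rfl, rfl⟩
  exact ⟨⟨v, mem_compOf hv⟩, fun w hw w' hw' => (reachable_symm (key w hw.2)).trans (key w' hw'.2)⟩

theorem le_compOf {K H : G.Subgraph} {v : V} (hH : H ≤ K) (hc : H.Connected) (hv : v ∈ H.verts) :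
    H ≤ K.compOf v := by
  have key : ∀ w ∈ H.verts, Relation.ReflTransGen K.Adj v w := by
    intro w hw
    refine Relation.ReflTransGen.mono ?_ _ _ (hc.2 v hv w hw)
    rintro _ _ ⟨e, he, h⟩
    exact ⟨e, hH.2 he, h⟩
  exact ⟨fun w hw => ⟨hH.1 hw, key w hw⟩,
    fun e he => ⟨hH.2 he, fun b => key _ (H.ends_mem e he b)⟩⟩

theorem isComponent_compOf {K : G.Subgraph} {v : V} (hv : v ∈ K.verts) :
    IsComponent (K.compOf v) K :=
  ⟨⟨compOf_le K v, connected_compOf hv⟩, fun _ hD hle => le_compOf hD.1 hD.2 (hle.1 (mem_compOf hv))⟩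

theorem IsComponent.eq_compOf {H K : G.Subgraph} {v : V} (h : IsComponent H K) (hv : v ∈ H.verts) :
    H = K.compOf v := by
  have h1 := le_compOf h.1.1 h.1.2 hv
  exact le_antisymm' h1 (h.2 ⟨compOf_le K v, connected_compOf (h.1.1.1 hv)⟩ h1)

theorem IsComponent.mem_of_edge {H K : G.Subgraph} (h : IsComponent H K) {e : E} {b : Bool}
    (he : e ∈ K.edges) (hv : G.vtx (e, b) ∈ H.verts) : e ∈ H.edges := by
  rw [h.eq_compOf hv]
  exact mem_edges_compOf he .refl

end Subgraph

open Subgraph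

theorem isComponent_induced_edges_nonempty {A : Set E} {H : G.Subgraph}
    (h : IsComponent H (G.induced A)) : H.edges.Nonempty := by
  obtain ⟨v, hv⟩ := h.1.2.1
  obtain ⟨e, he, b, rfl⟩ := h.1.1.1 hv
  exact ⟨e, h.mem_of_edge he hv⟩

theorem isComponent_deleteEdges {A : Set E} {H : G.Subgraph}
    (h : IsComponent H (G.induced Aᶜ)) : IsComponent H (G.deleteEdges A) := by
  obtain ⟨v, hv⟩ := h.1.2.1
  have hv' := h.1.1.1 hv
  have : H = (G.deleteEdges A).compOf v := by
    rw [h.eq_compOf hv]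
    refine Subgraph.ext (Set.ext fun w => ⟨fun hw => ⟨trivial, hw.2⟩, fun hw => ⟨?_, hw.2⟩⟩) rfl
    rcases Relation.ReflTransGen.cases_tail hw.2 with rfl | ⟨u, -, e, he, b, -, hb⟩
    · exact hv'
    · exact ⟨e, he, !b, hb⟩
  rw [this]
  exact isComponent_compOf trivial

/-- Boundary circles through a component are boundary circles of the component. -/
theorem boundary_component {A : Set E} {H : G.Subgraph} (hH : IsComponent H (G.induced A))
    {d d' : (E × Bool) × Bool} (h : Quot.mk (G.BoundaryStep A) d = Quot.mk (G.BoundaryStep A) d')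
    (hd : G.vtx d.1 ∈ H.verts) : G.vtx d'.1 ∈ H.verts ∧
      Quot.mk (G.BoundaryStep H.edges) d = Quot.mk (G.BoundaryStep H.edges) d' := by
  classical
  -- All points off `H` go to `none`; since no boundary step leads from `H` to a vertex outside it,
  -- the map is constant on boundary circles.
  let f : (E × Bool) × Bool → Option (Quot (G.BoundaryStep H.edges)) := fun d =>
    if G.vtx d.1 ∈ H.verts then some (Quot.mk _ d) else none
  have hf : ∀ x y, G.BoundaryStep A x y → f x = f y := by
    rintro _ _ (h | ⟨e, b, s, he⟩ | ⟨h, s, hh⟩)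
    · have hv : G.vtx (G.rot h) = G.vtx h :=
        ((G.sameCycle_iff h (G.rot h)).1 ⟨1, by simp⟩).symm
      simp only [f, hv]
      rw [Quot.sound (BoundaryStep.corner (C := H.edges) h)]
    · by_cases hv : G.vtx (e, b) ∈ H.verts
      · have he' := hH.mem_of_edge he hv
        have hv' := H.ends_mem e he' (!b)
        simp only [f, hv, hv', if_true]
        rw [Quot.sound (BoundaryStep.along e b s he')]
      · have hv' : G.vtx (e, !b) ∉ H.verts := fun hv' => by
          exact hv (H.ends_mem e (hH.mem_of_edge he hv') b)
        simp only [f, hv, hv', if_false]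
    · have hh' : h.1 ∉ H.edges := fun h' => hh (hH.1.1.2 h')
      simp only [f]
      rw [Quot.sound (BoundaryStep.across h s hh')]
  have := congrArg (Quot.lift f hf) h
  simp only [f, hd, if_true] at this
  by_cases hd' : G.vtx d'.1 ∈ H.verts
  · rw [if_pos hd'] at this
    exact ⟨hd', Option.some.inj this⟩
  · rw [if_neg hd'] at this
    exact absurd this (by simp)

theorem boundary_isolated {A : Set E} {d d' : (E × Bool) × Bool}
    (h : Quot.mk (G.BoundaryStep A) d = Quot.mk (G.BoundaryStep A) d')
    (hd : G.vtx d.1 ∉ (G.induced A).verts) : G.vtx d'.1 = G.vtx d.1 := by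
  refine (mem_iff_of_mk_eq (K := {x : (E × Bool) × Bool | G.vtx x.1 = G.vtx d.1}) ?_ h).1 rfl
  rintro _ _ (h | ⟨e, b, s, he⟩ | ⟨h, s, hh⟩)
  · have hv : G.vtx (G.rot h) = G.vtx h :=
      ((G.sameCycle_iff h (G.rot h)).1 ⟨1, by simp⟩).symm
    simp [hv]
  · have h1 : ∀ b, G.vtx (e, b) ≠ G.vtx d.1 := fun b hb => hd ⟨e, he, b, hb⟩
    simp [h1]
  · rfl

instance [Finite V] [Finite E] : Finite G.Subgraph :=
  Finite.of_injective (fun H : G.Subgraph => (H.verts, H.edges)) fun _ _ h =>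
    Subgraph.ext (Prod.mk.inj h).1 (Prod.mk.inj h).2

open Classical in
/-- The components of `G|_A`. -/
noncomputable def comps [Finite V] [Finite E] (G : RibbonGraph V E) (A : Set E) :
    Finset G.Subgraph :=
  (Set.toFinite {H | IsComponent H (G.induced A)}).toFinset

theorem mem_comps [Finite V] [Finite E] {A : Set E} {H : G.Subgraph} :
    H ∈ G.comps A ↔ IsComponent H (G.induced A) := by simp [comps]

theorem numBoundary_of_forall_exists {H : G.Subgraph} (hV : ∀ v, ∃ h, G.vtx h = v) :
    H.numBoundary = Nat.card {x : Quot (G.BoundaryStep H.edges) //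
      ∃ (h : E × Bool) (s : Bool), G.vtx h ∈ H.verts ∧ x = Quot.mk _ (h, s)} := by
  have : {v : V | v ∈ H.verts ∧ ∀ h : E × Bool, G.vtx h ≠ v} = ∅ := by
    ext v
    obtain ⟨h, rfl⟩ := hV v
    simp only [Set.mem_ofPred_eq, Set.mem_empty_iff_false, iff_false, not_and]
    exact fun _ hh => hh h rfl
  rw [numBoundary, this, Set.ncard_empty, add_zero]
  rfl

/-- Boundary circles of the components, together with one circle for each vertex incident to no edge
of `A`, are distinct boundary circles of the spanning subgraph on `A`. -/
theorem sum_numBoundary_add_card_le [Finite V] [Finite E] (hV : ∀ v, ∃ h, G.vtx h = v)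
    (A : Set E) : ∑ H ∈ G.comps A, H.numBoundary + Nat.card V ≤
      Nat.card (Quot (G.BoundaryStep A)) + ∑ H ∈ G.comps A, H.verts.ncard := by
  have h1 : ∑ H ∈ G.comps A, H.numBoundary + ((G.induced A).vertsᶜ).ncard ≤
      Nat.card (Quot (G.BoundaryStep A)) := by
    let B : G.comps A → Type _ := fun H => {x : Quot (G.BoundaryStep H.1.edges) //
      ∃ (h : E × Bool) (s : Bool), G.vtx h ∈ H.1.verts ∧ x = Quot.mk _ (h, s)}
    have e1 : ∑ H ∈ G.comps A, H.numBoundary = Nat.card (Σ H : G.comps A, B H) := by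
      rw [Nat.card_sigma, ← Finset.sum_coe_sort]
      exact Finset.sum_congr rfl fun H _ => numBoundary_of_forall_exists hV
    have e2 : ((G.induced A).vertsᶜ).ncard = Nat.card ((G.induced A).vertsᶜ : Set V) := rfl
    rw [e1, e2, ← Nat.card_sum]
    let F : (Σ H : G.comps A, B H) ⊕ ((G.induced A).vertsᶜ : Set V) → (E × Bool) × Bool :=
      Sum.elim (fun p => (p.2.2.choose, p.2.2.choose_spec.choose)) fun v => ((hV v).choose, false)
    have hF1 : ∀ p, G.vtx (F (Sum.inl p)).1 ∈ p.1.1.verts ∧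
        p.2.1 = Quot.mk (G.BoundaryStep p.1.1.edges) (F (Sum.inl p)) :=
      fun p => p.2.2.choose_spec.choose_spec
    have hF2 : ∀ v, G.vtx (F (Sum.inr v)).1 = v := fun v => (hV v).choose_spec
    refine Nat.card_le_card_of_injective (fun t => Quot.mk (G.BoundaryStep A) (F t)) ?_
    rintro (p | v) (q | w) h
    · obtain ⟨h1, h2⟩ := boundary_component (mem_comps.1 p.1.2) h (hF1 p).1
      have hpq : p.1 = q.1 := by
        apply Subtype.ext
        rw [(mem_comps.1 p.1.2).eq_compOf h1, (mem_comps.1 q.1.2).eq_compOf (hF1 q).1]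
      have hp2 := (hF1 p).2
      have hq2 := (hF1 q).2
      generalize F (Sum.inl p) = x at *
      generalize F (Sum.inl q) = y at *
      obtain ⟨H, p⟩ := p
      obtain ⟨H', q⟩ := q
      obtain rfl : H = H' := hpq
      have : p = q := Subtype.ext (hp2.trans (h2.trans hq2.symm))
      rw [this]
    · refine absurd ((mem_comps.1 p.1.2).1.1.1 (boundary_component (mem_comps.1 p.1.2) h
        (hF1 p).1).1) ?_
      rw [hF2]
      exact w.2
    · refine absurd ((mem_comps.1 q.1.2).1.1.1 (boundary_component (mem_comps.1 q.1.2) h.symm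
        (hF1 q).1).1) ?_
      rw [hF2]
      exact v.2
    · have := boundary_isolated h (by rw [hF2]; exact v.2)
      rw [hF2, hF2] at this
      rw [Subtype.ext this]
  have h2 : (G.induced A).verts.ncard ≤ ∑ H ∈ G.comps A, H.verts.ncard := by
    have e1 : ∑ H ∈ G.comps A, H.verts.ncard = Nat.card (Σ H : G.comps A, H.1.verts) := by
      rw [Nat.card_sigma, ← Finset.sum_coe_sort]
      rfl
    rw [e1]
    refine Nat.card_le_card_of_injective (fun v : (G.induced A).verts =>
      (⟨⟨_, mem_comps.2 (isComponent_compOf v.2)⟩, ⟨v.1, mem_compOf v.2⟩⟩ :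
        Σ H : G.comps A, H.1.verts)) ?_
    intro v w h
    have := congrArg (fun p : Σ H : G.comps A, H.1.verts => (p.2 : V)) h
    exact Subtype.ext this
  have h3 := Set.ncard_add_ncard_compl (G.induced A).verts
  omega

/-- A 1-sum shares one vertex and no edge, so `1 - v` and `e` are additive. -/
theorem Subgraph.IsIterated.sum_eq [Finite V] [Finite E] {K : G.Subgraph} {L : List G.Subgraph}
    (h : IsIterated IsOneSum K L) :
    (L.map fun H => (1 - H.verts.ncard : ℤ)).sum = 1 - K.verts.ncard ∧
      (L.map fun H => (H.edges.ncard : ℤ)).sum = K.edges.ncard := by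
  induction h with
  | single H => simp
  | snoc K K' H L _ hK ih =>
    obtain ⟨v, hK⟩ := hK
    have hv := Set.ncard_union_add_ncard_inter K.verts H.verts
    have he := Set.ncard_union_add_ncard_inter K.edges H.edges
    rw [← hK.verts_union, hK.verts_inter, Set.ncard_singleton] at hv
    rw [← hK.edges_union, hK.edges_inter, Set.ncard_empty] at he
    simp only [List.map_append, List.sum_append, ih, List.map_cons, List.map_nil, List.sum_cons,
      List.sum_nil]
    omega

theorem exists_vtx_eq [Nonempty E] (hG : G.Connected) (v : V) : ∃ h, G.vtx h = v := by
  obtain ⟨e⟩ := ‹Nonempty E›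
  rcases Relation.ReflTransGen.cases_tail (hG.2 (G.vtx (e, false)) trivial v trivial) with
    h | ⟨u, -, e, -, b, -, hb⟩
  · exact ⟨_, h.symm⟩
  · exact ⟨_, hb⟩

theorem isComponent_whole_iff (hG : G.Connected) {H : G.Subgraph} :
    IsComponent H G.whole ↔ H = G.whole := by
  have hle : ∀ D : G.Subgraph, D ≤ G.whole := fun D => ⟨fun _ _ => trivial, fun _ _ => trivial⟩
  constructor
  · exact fun h => le_antisymm' (hle H) (h.2 ⟨hle _, hG⟩ (hle H))
  · rintro rfl
    exact ⟨⟨hle _, hG⟩, fun D _ _ => hle D⟩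

theorem induced_univ [Nonempty E] (hG : G.Connected) : G.induced Set.univ = G.whole := by
  refine Subgraph.ext (Set.eq_univ_of_forall fun v => ?_) rfl
  obtain ⟨⟨e, b⟩, rfl⟩ := exists_vtx_eq hG v
  exact ⟨e, trivial, b, rfl⟩

theorem not_isComponent_induced_empty {H : G.Subgraph} : ¬ IsComponent H (G.induced ∅) := by
  intro h
  obtain ⟨e, he⟩ := isComponent_induced_edges_nonempty h
  exact h.1.1.2 he

theorem DefinesBiseparation.exists_list [Nonempty E] (hG : G.Connected) {A : Set E}
    (h : G.DefinesBiseparation A) : ∃ L : List G.Subgraph, L.Nodup ∧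
      (∀ H : G.Subgraph, H ∈ L ↔ (IsComponent H (G.induced A) ∨ IsComponent H (G.induced Aᶜ))) ∧
      IsIterated IsOneSum G.whole L := by
  rcases h with rfl | rfl | h
  · refine ⟨[G.whole], by simp, fun H => ?_, .single _⟩
    simp [induced_univ hG, isComponent_whole_iff hG, not_isComponent_induced_empty]
  · refine ⟨[G.whole], by simp, fun H => ?_, .single _⟩
    simp [induced_univ hG, isComponent_whole_iff hG, not_isComponent_induced_empty]
  · exact h

/-- For each summand `f - v = 2(1 - v) + e - γ`, with `γ` its Euler genus. Summing gives at least
`2(1 - |V|) + |E| - 1`, because the genera add up to at most one; the two bounds on spanning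
subgraphs then cancel `2|V|`. -/
theorem card_edges_lt_of_genus [Finite V] [Finite E] [Nonempty E] (hG : G.Connected) {A : Set E}
    (hA : G.DefinesBiseparation A) {C : G.Subgraph} (hC : C.eulerGenus ≤ 1)
    (hgen : ∀ D : G.Subgraph, G.IsPart A D → D ≠ C → D.eulerGenus ≤ 0) :
    Nat.card E + 1 ≤ Nat.card (Quot (G.BoundaryStep A)) + Nat.card (Quot (G.BoundaryStep Aᶜ)) := by
  classical
  obtain ⟨L, hnd, hL, hit⟩ := hA.exists_list hG
  have hV := exists_vtx_eq hG
  have b1 := sum_numBoundary_add_card_le hV A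
  have b2 := sum_numBoundary_add_card_le hV Aᶜ
  have hLu : L.toFinset = G.comps A ∪ G.comps Aᶜ := by
    ext H; simp [hL, mem_comps]
  have hdisj : Disjoint (G.comps A) (G.comps Aᶜ) := by
    refine Finset.disjoint_left.2 fun H h1 h2 => ?_
    obtain ⟨e, he⟩ := isComponent_induced_edges_nonempty (mem_comps.1 h1)
    exact (mem_comps.1 h2).1.1.2 he ((mem_comps.1 h1).1.1.2 he)
  have hsum : ∀ f : G.Subgraph → ℤ, (L.map f).sum = ∑ H ∈ G.comps A, f H + ∑ H ∈ G.comps Aᶜ, f H := by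
    intro f
    rw [← Finset.sum_union hdisj, ← hLu, List.sum_toFinset f hnd]
  obtain ⟨s1, s2⟩ := IsIterated.sum_eq hit
  have s3 : (L.map fun H => H.eulerGenus).sum ≤ 1 := by
    rw [← List.sum_toFinset _ hnd]
    calc ∑ H ∈ L.toFinset, H.eulerGenus ≤ ∑ H ∈ L.toFinset, if H = C then (1 : ℤ) else 0 := by
          refine Finset.sum_le_sum fun H hH => ?_
          split_ifs with hHC
          · rw [hHC]; exact hC
          · refine hgen H ?_ hHC
            rcases (hL H).1 (List.mem_toFinset.1 hH) with h | h
            · exact Or.inl h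
            · exact Or.inr (isComponent_deleteEdges h)
      _ ≤ 1 := by
          rw [Finset.sum_ite_eq']
          split_ifs <;> simp
  have hnb : ∀ H : G.Subgraph, (H.numBoundary : ℤ) - H.verts.ncard =
      2 * (1 - H.verts.ncard : ℤ) + H.edges.ncard - H.eulerGenus := by
    intro H; rw [eulerGenus]; ring
  have s4 : (L.map fun H => (H.numBoundary : ℤ) - H.verts.ncard).sum =
      2 * (1 - (G.whole.verts.ncard : ℤ)) + G.whole.edges.ncard -
        (L.map fun H => H.eulerGenus).sum := by
    rw [← s1, ← s2, ← List.sum_toFinset _ hnd, ← List.sum_toFinset _ hnd,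
      ← List.sum_toFinset _ hnd, ← List.sum_toFinset _ hnd, Finset.mul_sum, ← Finset.sum_add_distrib,
      ← Finset.sum_sub_distrib]
    exact Finset.sum_congr rfl fun H _ => hnb H
  rw [hsum, Finset.sum_sub_distrib, Finset.sum_sub_distrib] at s4
  have v1 : G.whole.verts.ncard = Nat.card V := Set.ncard_univ V
  have v2 : G.whole.edges.ncard = Nat.card E := Set.ncard_univ E
  zify at b1 b2 ⊢
  rw [v1, v2] at s4
  linarith

end RibbonGraph

/-! ### The medial graph of a ribbon graph; small cuts are joins -/

namespace RibbonGraph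

open Subgraph

variable {V E : Type*} {G : RibbonGraph V E}

/-- The other end of the arc of a vertex boundary between consecutive half-edges. -/
def corner (G : RibbonGraph V E) (d : (E × Bool) × Bool) : (E × Bool) × Bool :=
  if d.2 then (G.rot d.1, false) else (G.rot.symm d.1, true)

/-- The other end of the arc of a vertex boundary at a half-edge. -/
def across (d : (E × Bool) × Bool) : (E × Bool) × Bool := (d.1, !d.2)

/-- The other end of the side of a ribbon. -/
def along (G : RibbonGraph V E) (d : (E × Bool) × Bool) : (E × Bool) × Bool :=
  ((d.1.1, !d.1.2), if G.twisted d.1.1 then d.2 else !d.2)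

/-- The edge of a point. -/
def edgeOf (d : (E × Bool) × Bool) : E := d.1.1

theorem corner_invol (d : (E × Bool) × Bool) : G.corner (G.corner d) = d := by
  rcases d with ⟨h, _ | _⟩ <;> simp [corner]

theorem corner_ne (d : (E × Bool) × Bool) : G.corner d ≠ d := by
  rcases d with ⟨h, _ | _⟩ <;> simp [corner]

/-- On each edge the two pairings are translations by distinct non-zero elements of the Klein
four-group, whether the ribbon is twisted or not. -/
theorem transitionPair (G : RibbonGraph V E) :
    TransitionPair (edgeOf (E := E)) across G.along where
  left := ⟨fun d => by simp [across], fun d => by rcases d with ⟨h, _ | _⟩ <;> simp [across],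
    fun d => rfl⟩
  right := by
    refine ⟨fun d => ?_, fun d => ?_, fun d => rfl⟩
    · rcases d with ⟨⟨e, b⟩, s⟩
      by_cases h : G.twisted e <;> simp [along, h]
    · rcases d with ⟨⟨e, _ | _⟩, s⟩ <;> simp [along]
  gen := by
    rintro ⟨⟨e, b⟩, s⟩ ⟨⟨e', b'⟩, s'⟩ h
    obtain rfl : e = e' := h
    by_cases h : G.twisted e <;> cases b <;> cases b' <;> cases s <;> cases s' <;>
      simp [along, across, h]
  surj e := ⟨((e, false), false), rfl⟩
  comm := by
    rintro ⟨⟨e, b⟩, s⟩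
    by_cases h : G.twisted e <;> simp [along, across, h]
  card := by
    simp only [Nat.card_prod, Nat.card_eq_fintype_card, Fintype.card_bool]
    ring

theorem card_boundary_le [Finite E] (A : Set E) : Nat.card (Quot (G.BoundaryStep A)) ≤
    numCirc G.corner (swapOn edgeOf A across G.along) := by
  refine card_quot_le ?_
  rintro ⟨h, s⟩ _ (rfl | rfl)
  · cases s
    · have := Quot.sound (BoundaryStep.corner (G := G) (C := A) (G.rot.symm h))
      simpa [corner] using this.symm
    · simpa [corner] using Quot.sound (BoundaryStep.corner (G := G) (C := A) h)
  · by_cases hA : h.1 ∈ A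
    · rw [swapOn_of_mem (show edgeOf (h, s) ∈ A from hA)]
      exact Quot.sound (BoundaryStep.along h.1 h.2 s hA)
    · rw [swapOn_of_notMem (show edgeOf (h, s) ∉ A from hA)]
      exact Quot.sound (BoundaryStep.across h s hA)

theorem medial_eq_of_vtx_eq [Finite E] {h h' : E × Bool} (hv : G.vtx h = G.vtx h') :
    Quot.mk (MedialAdj edgeOf G.corner) h.1 = Quot.mk (MedialAdj edgeOf G.corner) h'.1 := by
  obtain ⟨i, -, rfl⟩ := ((G.sameCycle_iff h h').2 hv).exists_pow_eq'
  clear hv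
  induction i with
  | zero => rfl
  | succ i ih =>
    rw [ih, pow_succ', Equiv.Perm.mul_apply]
    exact Quot.sound ⟨((G.rot ^ i) h, true), rfl, by simp [corner, edgeOf]⟩

theorem medial_eq [Finite E] (hG : G.Connected) (e e' : E) :
    Quot.mk (MedialAdj edgeOf G.corner) e = Quot.mk (MedialAdj edgeOf G.corner) e' := by
  have key : ∀ v, Relation.ReflTransGen G.whole.Adj (G.vtx (e, false)) v → ∀ h, G.vtx h = v →
      Quot.mk (MedialAdj edgeOf G.corner) e = Quot.mk (MedialAdj edgeOf G.corner) h.1 := by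
    intro v hv
    induction hv with
    | refl => exact fun h hh => medial_eq_of_vtx_eq (h := (e, false)) hh.symm
    | tail _ hadj ih =>
      obtain ⟨f, -, b, rfl, rfl⟩ := hadj
      exact fun h hh => (ih (f, b) rfl).trans (medial_eq_of_vtx_eq (h := (f, !b)) hh.symm)
  exact key _ (hG.2 _ trivial _ trivial) (e', false) rfl

theorem numMedial_le_one [Finite E] (hG : G.Connected) : numMedial edgeOf G.corner ≤ 1 := by
  rw [numMedial, Finite.card_le_one_iff_subsingleton]
  refine ⟨fun p q => ?_⟩
  induction p using Quot.ind
  induction q using Quot.ind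
  exact medial_eq hG _ _

/-- A set containing some but not all half-edges at a vertex is left by the rotation there. -/
theorem exists_leaving [Finite E] {S : Set (E × Bool)} {h h' : E × Bool} (hv : G.vtx h = G.vtx h')
    (hh : h ∈ S) (hh' : h' ∉ S) : ∃ x ∈ S, G.rot x ∉ S ∧ G.vtx x = G.vtx h := by
  by_contra! hcon
  obtain ⟨i, -, rfl⟩ := ((G.sameCycle_iff h h').2 hv).exists_pow_eq'
  apply hh'
  clear hv hh'
  have : ∀ i, (G.rot ^ i) h ∈ S := by
    intro i
    induction i with
    | zero => exact hh
    | succ i ih =>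
      rw [pow_succ', Equiv.Perm.mul_apply]
      by_contra hn
      refine hcon _ ih hn ((G.sameCycle_iff _ _).1 ?_)
      exact Equiv.Perm.SameCycle.symm ⟨i, by simp⟩
  exact this i

/-- Follow a path of `G` towards `v`. It can leave `X` only at a vertex shared with the complement,
which is `v` itself. -/
theorem connected_induced [Finite E] (hG : G.Connected) {X : Set E} {v : V}
    (hv : v ∈ (G.induced X).verts)
    (hsh : ∀ w ∈ (G.induced X).verts, w ∈ (G.induced Xᶜ).verts → w = v) :
    (G.induced X).Connected := by
  have key : ∀ w, Relation.ReflTransGen G.whole.Adj w v → w ∈ (G.induced X).verts →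
      Relation.ReflTransGen (G.induced X).Adj w v := by
    intro w hw
    induction hw using Relation.ReflTransGen.head_induction_on with
    | refl => exact fun _ => .refl
    | head hadj _ ih =>
      obtain ⟨e, -, b, rfl, rfl⟩ := hadj
      intro hwX
      by_cases he : e ∈ X
      · exact (ih ⟨e, he, !b, rfl⟩).head ⟨e, he, b, rfl, rfl⟩
      · rw [hsh _ hwX ⟨e, he, b, rfl⟩]
  refine ⟨⟨v, hv⟩, fun w hw w' hw' => ?_⟩
  exact (key w (hG.2 _ trivial _ trivial) hw).trans
    (reachable_symm (key w' (hG.2 _ trivial _ trivial) hw'))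

/-- A cut of the medial graph with one corner in each direction is a join. -/
theorem isJoin_of_unique_corners [Finite E] (hG : G.Connected) {X : Set E} {h₀ h₁ : E × Bool}
    (hin : ∀ h, h.1 ∈ X ∧ (G.rot.symm h).1 ∉ X ↔ h = h₀)
    (hout : ∀ h, h.1 ∈ X ∧ (G.rot h).1 ∉ X ↔ h = h₁) :
    IsJoin G.whole (G.induced X) (G.induced Xᶜ) := by
  obtain ⟨i0, i1⟩ := (hin h₀).2 rfl
  obtain ⟨o0, o1⟩ := (hout h₁).2 rfl
  have hrv : ∀ h, G.vtx (G.rot h) = G.vtx h := fun h =>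
    ((G.sameCycle_iff h (G.rot h)).1 ⟨1, by simp⟩).symm
  have hrv' : ∀ h, G.vtx (G.rot.symm h) = G.vtx h := fun h => by
    rw [← hrv (G.rot.symm h), Equiv.apply_symm_apply]
  have hsh : ∀ w ∈ (G.induced X).verts, w ∈ (G.induced Xᶜ).verts → w = G.vtx h₁ := by
    rintro w ⟨e, he, b, rfl⟩ ⟨e', he', b', hw⟩
    obtain ⟨x, hx, hx', hxv⟩ := exists_leaving (S := {h | h.1 ∈ X}) hw.symm he he'
    rw [← hxv, (hout x).1 ⟨hx, hx'⟩]
  have hvP : G.vtx h₁ ∈ (G.induced X).verts := ⟨h₁.1, o0, h₁.2, rfl⟩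
  have hvQ : G.vtx h₁ ∈ (G.induced Xᶜ).verts := ⟨(G.rot h₁).1, o1, (G.rot h₁).2, hrv h₁⟩
  have hv₀ : G.vtx h₀ = G.vtx h₁ :=
    hsh _ ⟨h₀.1, i0, h₀.2, rfl⟩ ⟨(G.rot.symm h₀).1, i1, (G.rot.symm h₀).2, hrv' h₀⟩
  have : Nonempty E := ⟨h₁.1⟩
  refine ⟨G.vtx h₁, ⟨connected_induced hG hvP hsh, ?_, ⟨_, o0⟩, ⟨_, o1⟩, ?_, ?_, ?_, ?_⟩, ?_⟩
  · refine connected_induced hG hvQ fun w hw hw' => hsh w ?_ hw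
    rwa [compl_compl] at hw'
  · refine (Set.eq_univ_of_forall fun w => ?_).symm
    obtain ⟨⟨e, b⟩, rfl⟩ := exists_vtx_eq hG w
    by_cases he : e ∈ X
    · exact Or.inl ⟨e, he, b, rfl⟩
    · exact Or.inr ⟨e, he, b, rfl⟩
  · exact (Set.union_compl_self X).symm
  · ext w
    exact ⟨fun hw => hsh w hw.1 hw.2, fun hw => by
      rw [Set.mem_singleton_iff] at hw; subst hw; exact ⟨hvP, hvQ⟩⟩
  · exact Set.inter_compl_self X
  · have hex : ∃ n, ((G.rot ^ n) h₀).1 ∉ X := by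
      obtain ⟨i, -, hi⟩ := ((G.sameCycle_iff h₀ (G.rot h₁)).2
        (hv₀.trans (hrv h₁).symm)).exists_pow_eq'
      exact ⟨i, by rw [hi]; exact o1⟩
    classical
    -- The arc runs from the unique entry into `X` up to the first half-edge outside `X`.
    refine ⟨h₀, Nat.find hex, hv₀, fun h hhv hhX => ?_, fun i hi => ?_⟩
    · by_contra hcon
      -- Half-edges of `X` missed by the arc. The predecessor of one is again missed, as entry
      -- happens only at `h₀`; so the rotation never enters `S`, although it would have to on the
      -- way from `h₀` to `h`.
      let S : Set (E × Bool) := {x | x.1 ∈ X ∧ ¬ ∃ i < Nat.find hex, (G.rot ^ i) h₀ = x}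
      have hpos : 0 < Nat.find hex := by
        rw [Nat.find_pos]; simpa using i0
      have hS : ∀ x ∈ S, G.rot.symm x ∈ S := by
        rintro x ⟨hx, hx'⟩
        have hxX : (G.rot.symm x).1 ∈ X := by
          by_contra hn
          exact hx' ⟨0, hpos, by simpa using ((hin x).1 ⟨hx, hn⟩).symm⟩
        refine ⟨hxX, ?_⟩
        rintro ⟨i, hi, hix⟩
        have hix' : (G.rot ^ (i + 1)) h₀ = x := by
          rw [pow_succ', Equiv.Perm.mul_apply, hix, Equiv.apply_symm_apply]
        rcases Nat.lt_or_ge (i + 1) (Nat.find hex) with hlt | hge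
        · exact hx' ⟨i + 1, hlt, hix'⟩
        · have he : Nat.find hex = i + 1 := by omega
          have := Nat.find_spec hex
          rw [he, hix'] at this
          exact this hx
      obtain ⟨x, hx, hx', -⟩ := exists_leaving (S := Sᶜ) (h := h₀) (h' := h) (hv₀.trans hhv.symm)
        (fun h => h.2 ⟨0, hpos, rfl⟩) (fun h => h ⟨hhX, hcon⟩)
      exact hx (by simpa using hS _ (not_not.1 hx'))
    · exact fun hn => hn (not_not.1 (Nat.find_min hex hi))

/-- A permutation of a finite set enters a subset as often as it leaves it. -/
theorem ncard_leaving_eq [Finite E] (X : Set E) :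
    {h : E × Bool | h.1 ∈ X ∧ (G.rot.symm h).1 ∉ X}.ncard =
      {h : E × Bool | h.1 ∈ X ∧ (G.rot h).1 ∉ X}.ncard := by
  set S : Set (E × Bool) := {h | h.1 ∈ X}
  have e1 := Set.ncard_inter_add_ncard_sdiff_eq_ncard S (G.rot ⁻¹' S) S.toFinite
  have e2 := Set.ncard_inter_add_ncard_sdiff_eq_ncard S (G.rot.symm ⁻¹' S) S.toFinite
  have e3 : (S ∩ G.rot.symm ⁻¹' S).ncard = (S ∩ G.rot ⁻¹' S).ncard := by
    rw [← Set.ncard_image_of_injective (S ∩ G.rot ⁻¹' S) G.rot.injective]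
    congr 1
    ext h
    constructor
    · rintro ⟨h1, h2⟩
      exact ⟨G.rot.symm h, ⟨h2, by simpa using h1⟩, by simp⟩
    · rintro ⟨h, ⟨h1, h2⟩, rfl⟩
      exact ⟨h2, by simpa using h1⟩
  have e4 : S \ G.rot.symm ⁻¹' S = {h : E × Bool | h.1 ∈ X ∧ (G.rot.symm h).1 ∉ X} := rfl
  have e5 : S \ G.rot ⁻¹' S = {h : E × Bool | h.1 ∈ X ∧ (G.rot h).1 ∉ X} := rfl
  rw [e4] at e2
  rw [e5] at e1
  omega

theorem ncard_cutPts_corner [Finite E] (X : Set E) : (cutPts edgeOf G.corner X).ncard =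
    2 * {h : E × Bool | h.1 ∈ X ∧ (G.rot h).1 ∉ X}.ncard := by
  have hu : cutPts edgeOf G.corner X =
      (fun h => (h, true)) '' {h : E × Bool | h.1 ∈ X ∧ (G.rot h).1 ∉ X} ∪
        (fun h => (h, false)) '' {h : E × Bool | h.1 ∈ X ∧ (G.rot.symm h).1 ∉ X} := by
    ext ⟨h, _ | _⟩ <;> simp [cutPts, edgeOf, corner]
  have hd : Disjoint ((fun h => (h, true)) '' {h : E × Bool | h.1 ∈ X ∧ (G.rot h).1 ∉ X})
      ((fun h => (h, false)) '' {h : E × Bool | h.1 ∈ X ∧ (G.rot.symm h).1 ∉ X}) := by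
    refine Set.disjoint_left.2 ?_
    rintro _ ⟨h, -, rfl⟩ ⟨h', -, h2⟩
    exact absurd (congrArg Prod.snd h2) (by simp)
  have hinj : ∀ b : Bool, Function.Injective fun h : E × Bool => (h, b) :=
    fun b h h' e => (Prod.mk.inj e).1
  rw [hu, Set.ncard_union_eq hd, Set.ncard_image_of_injective _ (hinj true),
    Set.ncard_image_of_injective _ (hinj false), ncard_leaving_eq, two_mul]

/-- The rotation leaves `X` at most once overall. If never, connectedness of the medial graph makes
`X` empty or everything, the latter being the one-term join; if once, it also enters once and `X` is
a join-summand. -/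
theorem relatedByToggling_of_small_cut [Finite E] (hG : G.Connected) {X : Set E}
    (hX : (cutPts edgeOf G.corner X).ncard ≤ 2) (A : Set E) :
    G.RelatedByToggling A (symmDiff A X) := by
  rw [ncard_cutPts_corner] at hX
  have hcases : {h : E × Bool | h.1 ∈ X ∧ (G.rot h).1 ∉ X}.ncard = 0 ∨
      {h : E × Bool | h.1 ∈ X ∧ (G.rot h).1 ∉ X}.ncard = 1 := by omega
  rcases hcases with h0 | h1
  · have hc0 : cutPts edgeOf G.corner X = ∅ := by
      rw [← Set.ncard_eq_zero, ncard_cutPts_corner, h0]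
    have hmem : ∀ e e', e ∈ X → e' ∈ X := by
      intro e e' he
      refine (mem_iff_of_mk_eq ?_ (medial_eq hG e e')).1 he
      have hstep : ∀ d, edgeOf d ∈ X → edgeOf (G.corner d) ∈ X := by
        intro d hd
        by_contra hn
        exact (hc0 ▸ (⟨hd, hn⟩ : d ∈ cutPts edgeOf G.corner X) : d ∈ (∅ : Set _))
      rintro _ _ ⟨d, rfl, rfl⟩
      exact ⟨hstep d, fun h => by simpa [corner_invol] using hstep _ h⟩
    rcases X.eq_empty_or_nonempty with rfl | ⟨e, he⟩
    · rw [← Set.bot_eq_empty, symmDiff_bot]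
      exact .refl
    · obtain rfl : X = Set.univ := Set.eq_univ_of_forall fun e' => hmem e e' he
      exact .single ⟨[G.whole], .single _, G.whole, by simp, rfl⟩
  · have h1' := ncard_leaving_eq (G := G) X
    rw [h1] at h1'
    obtain ⟨h₁, hout⟩ := Set.ncard_eq_one.1 h1
    obtain ⟨h₀, hin⟩ := Set.ncard_eq_one.1 h1'
    have hj := isJoin_of_unique_corners hG (X := X) (fun h => Set.ext_iff.1 hin h)
      (fun h => Set.ext_iff.1 hout h)
    exact .single ⟨[G.induced X] ++ [G.induced Xᶜ], .snoc _ _ _ _ (.single _) hj, G.induced X,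
      by simp, rfl⟩

theorem relatedByToggling_of_cutGenerated [Finite E] (hG : G.Connected) {X : Set E}
    (hX : CutGenerated edgeOf G.corner X) (A : Set E) : G.RelatedByToggling A (symmDiff A X) := by
  induction hX generalizing A with
  | cut X hX => exact relatedByToggling_of_small_cut hG hX A
  | symmDiff X Y _ _ ihX ihY =>
    rw [← symmDiff_assoc]
    exact (ihX A).trans (ihY _)

/-- The transition pair of `A` turns into that of `B` by exchange on `A Δ B`. As the medial graph
has at most one component, the two inequalities say that the Euler genus is at most one before and
after. -/
theorem relatedByToggling_of_card_le [Finite E] (hG : G.Connected) {A B : Set E}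
    (hA : Nat.card E + 1 ≤
      Nat.card (Quot (G.BoundaryStep A)) + Nat.card (Quot (G.BoundaryStep Aᶜ)))
    (hB : Nat.card E + 1 ≤
      Nat.card (Quot (G.BoundaryStep B)) + Nat.card (Quot (G.BoundaryStep Bᶜ))) :
    G.RelatedByToggling A B := by
  have hcompl : ∀ C : Set E, swapOn edgeOf Cᶜ across G.along = swapOn edgeOf C G.along across := by
    intro C
    funext d
    by_cases h : edgeOf d ∈ C <;> simp [swapOn, h]
  have hswap : ∀ σ τ : (E × Bool) × Bool → (E × Bool) × Bool,
      swapOn edgeOf (symmDiff A B) (swapOn edgeOf A σ τ) (swapOn edgeOf A τ σ) =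
        swapOn edgeOf B σ τ := by
    intro σ τ
    funext d
    by_cases h : edgeOf d ∈ A <;> by_cases h' : edgeOf d ∈ B <;>
      simp [swapOn, h, h', Set.mem_symmDiff]
  have a1 := card_boundary_le (G := G) A
  have a2 := card_boundary_le (G := G) Aᶜ
  have b1 := card_boundary_le (G := G) B
  have b2 := card_boundary_le (G := G) Bᶜ
  rw [hcompl] at a2 b2
  have hk := numMedial_le_one hG
  have hgen : CutGenerated edgeOf G.corner (symmDiff A B) := by
    refine (G.transitionPair.swapOn A).cutGenerated (symmDiff A B) corner_invol corner_ne
      (by omega) ?_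
    rw [hswap, hswap]
    omega
  simpa using relatedByToggling_of_cutGenerated hG hgen A

end RibbonGraph

theorem theorem4p5 {V E : Type*} [Finite V] [Finite E] (G : RibbonGraph V E)
    (hG : G.Connected) (A B : Set E)
    (hAB : (G.DefinesPlaneBiseparation A ∧ G.DefinesPlaneBiseparation B) ∨
      (G.DefinesRP2Biseparation A ∧ G.DefinesRP2Biseparation B)) :
    G.RelatedByToggling A B := by
  rcases isEmpty_or_nonempty E with hE | hE
  · rw [Subsingleton.elim A B]
    exact .refl
  · have hplane : ∀ A, G.DefinesPlaneBiseparation A → Nat.card E + 1 ≤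
        Nat.card (Quot (G.BoundaryStep A)) + Nat.card (Quot (G.BoundaryStep Aᶜ)) := by
      rintro A ⟨hA, hgen⟩
      obtain ⟨v, -⟩ := hG.1
      -- In the plane case any component may play the role of the exceptional one.
      have hC : G.IsPart A ((G.deleteEdges A).compOf v) :=
        Or.inr (RibbonGraph.Subgraph.isComponent_compOf trivial)
      exact RibbonGraph.card_edges_lt_of_genus hG hA (by rw [(hgen _ hC).2]; simp)
        fun D hD _ => (hgen D hD).2.le
    have hrp2 : ∀ A, G.DefinesRP2Biseparation A → Nat.card E + 1 ≤
        Nat.card (Quot (G.BoundaryStep A)) + Nat.card (Quot (G.BoundaryStep Aᶜ)) := by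
      rintro A ⟨hA, C, -, hC, hgen⟩
      exact RibbonGraph.card_edges_lt_of_genus hG hA hC.2.le fun D hD hDC => (hgen D hD hDC).2.le
    rcases hAB with ⟨hA, hB⟩ | ⟨hA, hB⟩
    · exact RibbonGraph.relatedByToggling_of_card_le hG (hplane A hA) (hplane B hB)
    · exact RibbonGraph.relatedByToggling_of_card_le hG (hrp2 A hA) (hrp2 B hB)
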